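/- Let $V$ be a finite set of $N\ge 1$ sites and $d\ge 1$ an integer. To each site one associates the Hilbert space $\mathbb{C}^d$, and $\mathcal{D}((\mathbb{C}^d)^{\otimes N})$ denotes the set of states (density operators) on $(\mathbb{C}^d)^{\otimes N}$. For a state $\rho$ and distinct sites $i,j$, let $\rho^{i,j}$ be the reduction (partial trace) of $\rho$ to the sites $i$ and $j$, and let $\|X\|_1=\operatorname{tr}\sqrt{X^\dagger X}$ be the trace norm. A state is globally separable if it is a convex combination of product states $\bigotimes_{i\in V}\tau_i$, where each $\tau_i$ is a state on $\mathbb{C}^d$. For a simple graph $(V,E)$ with at least one edge write $\mathbb{E}_{(i,j)\sim E}f(i,j)=\frac{1}{|E|}\sum_{\{i,j\}\in E}f(i,j)$ for the uniform average over the edges. (a) If $(V,E)$ is $c$-regular with $c\ge 1$, then for every $\rho\in\mathcal{D}((\mathbb{C}^d)^{\otimes N})$ there exists a globally separable state $\sigma$ such that $$\mathbb{E}_{(i,j)\sim E}\|\rho^{i,j}-\sigma^{i,j}\|_1\le 12\left(\frac{d^2\ln d}{c}\right)^{1/3}.$$ (b) If $N\ge 2$ and $(V,E)$ is a star, in which $N-1$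 leaves are each joined to one root (and there are no other edges), then for every $\rho\in\mathcal{D}((\mathbb{C}^d)^{\otimes N})$ there exists a globally separable state $\sigma$ such that $$\mathbb{E}_{(i,j)\sim E}\|\rho^{i,j}-\sigma^{i,j}\|_1\le 22\left(\frac{d^2\ln d}{N-1}\right)^{1/3}.$$ -/

import Mathlib

noncomputable section

namespace QuditGraph

open scoped ComplexOrder

/-- A density matrix: positive semidefinite with unit trace. -/
structure IsState {ι : Type*} [Fintype ι] (ρ : Matrix ι ι ℂ) : Prop where
  posSemidef : ρ.PosSemidef
  trace_eq_one : ρ.trace = 1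

/-- The trace norm (Schatten 1-norm): the sum of the singular values, that is, of the square roots
of the eigenvalues of `Aᴴ * A`. -/
def traceNorm {ι : Type*} [Fintype ι] [DecidableEq ι] (A : Matrix ι ι ℂ) : ℝ :=
  ∑ i, √((Matrix.isHermitian_conjTranspose_mul_self A).eigenvalues i)

variable {V : Type*} [Fintype V] [DecidableEq V] {d : ℕ}

/-- The configuration on all sites that equals `a` on the sites in `S` and `z` elsewhere. -/
def glue (S : Finset V) (a : {i // i ∈ S} → Fin d) (z : {i // i ∉ S} → Fin d) : V → Fin d :=
  (Equiv.piEquivPiSubtypeProd (fun i => i ∈ S) (fun _ => Fin d)).symm (a, z)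

/-- The reduction of an operator on `(ℂ^d)^{⊗ V}` (written in the computational basis, which is
indexed by `V → Fin d`) to the sites in `S`: the partial trace over all sites outside `S`. -/
def reduce (S : Finset V) (ρ : Matrix (V → Fin d) (V → Fin d) ℂ) :
    Matrix ({i // i ∈ S} → Fin d) ({i // i ∈ S} → Fin d) ℂ :=
  fun a b => ∑ z : {i // i ∉ S} → Fin d, ρ (glue S a z) (glue S b z)

/-- The tensor product over the sites of the local operators `τ i`. -/
def tensor (τ : V → Matrix (Fin d) (Fin d) ℂ) : Matrix (V → Fin d) (V → Fin d) ℂ :=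
  fun x y => ∏ i, τ i (x i) (y i)

/-- Globally (fully) separable states: convex combinations of product states. -/
def IsSeparable (σ : Matrix (V → Fin d) (V → Fin d) ℂ) : Prop :=
  σ ∈ convexHull ℝ {ω : Matrix (V → Fin d) (V → Fin d) ℂ |
    ∃ τ : V → Matrix (Fin d) (Fin d) ℂ, (∀ i, IsState (τ i)) ∧ ω = tensor τ}

/-- The average, over a uniformly random edge `{i, j}` of `G`, of the trace-norm distance between
the two-site reductions of `ρ` and `σ` to `{i, j}`. -/
def edgeDist (G : SimpleGraph V) [DecidableRel G.Adj]
    (ρ σ : Matrix (V → Fin d) (V → Fin d) ℂ) : ℝ :=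
  (∑ e ∈ G.edgeFinset, traceNorm (reduce e.toFinset ρ - reduce e.toFinset σ)) /
    (G.edgeFinset.card : ℝ)

end QuditGraph

end

/-!
The separable state comes from measuring a set `C` of sites and replacing the state of the
remaining sites, conditionally on the string of outcomes, by the product of its one-site marginals
(`sepApprox`). An edge that meets `C` contributes at most `2` to the error, the largest trace-norm
distance of two states. On an edge `{i, j}` that avoids `C` the error is the average over the
outcomes of the conditional correlation `ρ_{ij} - ρ_i ⊗ ρ_j`.

The correlation is measured by purity instead of entropy. If site `j` is measured as well, the
mean purity `tr (ρ_i²)` grows by the variance of the conditional state of `i`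
(`sum_purity_sub_purity`). The measurement used here consists of the rank-one operators along
`|k⟩ + iˢ |l⟩`, `s = 0, 1, 2, 3`. Its outcomes for fixed `k, l` have total probability of order
`(r_k + r_l) / d`, with `r` the diagonal of `ρ_j`, and Fourier analysis over `s` recovers the
block `X_{kl}` of the correlation: `‖X_{kl}‖² ≤ 4 d (r_k + r_l) G_{kl}` in Frobenius norm, where
`∑ G_{kl}` is the gain in purity (`frobSq_correl_single_le`). The trace norm of `X` is `tr (X Ω)`
for a partial isometry `Ω`, whose block rows and columns have squared Frobenius norm at most `d`.
The Cauchy–Schwarz inequality with weights `r_k + r_l` turns the bound on the blocks into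
`‖X‖₁ ≤ 2 √2 d √G`, with `G` the total gain; it is kept in the linearised form `d (t + 2 G / t)`,
so that averages over outcomes and edges need no convexity argument (`norm_sum_correl_mul_le`,
`traceNorm_reduce_sub_le`).

Since the purity of a site never exceeds `1`, the gains cannot all be large. Let `C` maximise the
total purity minus `B |C|`. Then `C` has at most `|V| / B` sites, and no further site gains more
than `B`. For a regular graph this bounds the average gain over the edges by `B / c`, and choosing
`B = 1 / q` and `t = q / d` with `q = (d² / c) ^ (1 / 3)` gives a total error `7 q`. For a star
only the purity of the root is needed, `C` consists of leaves, and the error is `5 q`.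
-/

noncomputable section

namespace QuditGraph

open scoped ComplexOrder
open Matrix

/-! ### The trace norm and partial isometries -/

section TraceNorm

variable {ι : Type*} [Fintype ι] [DecidableEq ι]

open scoped MatrixOrder in
theorem exists_eq_conjTranspose_mul_self {A : Matrix ι ι ℂ} (hA : A.PosSemidef) :
    ∃ B : Matrix ι ι ℂ, A = Bᴴ * B :=
  CStarAlgebra.nonneg_iff_eq_star_mul_self.mp hA.nonneg

/-- Half of the polar decomposition: the trace norm is attained by pairing with a partial
isometry. -/
theorem exists_partialIsometry_trace_mul_eq_traceNorm (A : Matrix ι ι ℂ) :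
    ∃ Ω : Matrix ι ι ℂ, Ω * Ωᴴ * Ω = Ω ∧ (A * Ω).trace = (traceNorm A : ℂ) := by
  set l : ι → ℝ := (Matrix.isHermitian_conjTranspose_mul_self A).eigenvalues with hl
  set U : Matrix ι ι ℂ :=
    ((Matrix.isHermitian_conjTranspose_mul_self A).eigenvectorUnitary : Matrix ι ι ℂ) with hU
  have hUU : Uᴴ * U = 1 := Unitary.coe_star_mul_self
    (Matrix.isHermitian_conjTranspose_mul_self A).eigenvectorUnitary
  have hspec : Aᴴ * A = U * diagonal (fun i => (l i : ℂ)) * Uᴴ := by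
    have := (Matrix.isHermitian_conjTranspose_mul_self A).spectral_theorem
    rw [Unitary.conjStarAlgAut_apply] at this
    exact this
  have hnn : ∀ i, 0 ≤ l i := fun i =>
    (posSemidef_conjTranspose_mul_self A).eigenvalues_nonneg i
  set D : Matrix ι ι ℂ := diagonal fun i => (((√(l i))⁻¹ : ℝ) : ℂ) with hD
  have hDH : Dᴴ = D := by
    rw [hD, diagonal_conjTranspose]; congr 1; ext i; simp
  have hDD : D * diagonal (fun i => (l i : ℂ)) = diagonal fun i => ((√(l i) : ℝ) : ℂ) := by
    rw [hD, diagonal_mul_diagonal]; congr 1; ext i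
    rw [← Complex.ofReal_mul]
    congr 1
    nth_rw 2 [← Real.mul_self_sqrt (hnn i)]
    rcases eq_or_ne (√(l i)) 0 with h | h
    · simp [h]
    · field_simp
  have hDDD : D * diagonal (fun i => (l i : ℂ)) * D * D = D := by
    rw [hDD, hD, diagonal_mul_diagonal, diagonal_mul_diagonal]; congr 1; ext i
    rcases eq_or_ne (√(l i)) 0 with h | h
    · simp [h]
    · rw [← Complex.ofReal_mul, ← Complex.ofReal_mul]
      congr 1
      field_simp
  refine ⟨U * D * Uᴴ * Aᴴ, ?_, ?_⟩
  · have e1 : (U * D * Uᴴ * Aᴴ)ᴴ = A * (U * D * Uᴴ) := by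
      simp only [conjTranspose_mul, conjTranspose_conjTranspose, hDH, Matrix.mul_assoc]
    calc U * D * Uᴴ * Aᴴ * (U * D * Uᴴ * Aᴴ)ᴴ * (U * D * Uᴴ * Aᴴ)
        = U * D * Uᴴ * (Aᴴ * A) * (U * D * Uᴴ) * (U * D * Uᴴ * Aᴴ) := by
          rw [e1]; simp only [Matrix.mul_assoc]
      _ = U * (D * (Uᴴ * U) * diagonal (fun i => (l i : ℂ)) * (Uᴴ * U) * D * (Uᴴ * U) * D) * Uᴴ
            * Aᴴ := by
          rw [hspec]; simp only [Matrix.mul_assoc]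
      _ = U * D * Uᴴ * Aᴴ := by
          rw [hUU]; simp only [Matrix.mul_one, hDDD]
  · calc (A * (U * D * Uᴴ * Aᴴ)).trace = (U * D * Uᴴ * (Aᴴ * A)).trace := by
          rw [trace_mul_comm]; simp only [Matrix.mul_assoc]
      _ = (U * (D * (Uᴴ * U) * diagonal (fun i => (l i : ℂ))) * Uᴴ).trace := by
          rw [hspec]; simp only [Matrix.mul_assoc]
      _ = (D * diagonal (fun i => (l i : ℂ))).trace := by
          rw [trace_mul_comm, ← Matrix.mul_assoc, hUU]; simp
      _ = (traceNorm A : ℂ) := by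
          rw [hDD, trace_diagonal, traceNorm, Complex.ofReal_sum]

/-- Every column of a partial isometry has Euclidean norm at most one. -/
theorem sum_norm_sq_col_le_one {Ω : Matrix ι ι ℂ} (h : Ω * Ωᴴ * Ω = Ω) (e : ι) :
    ∑ f, ‖Ω f e‖ ^ 2 ≤ 1 := by
  have hE : (1 - Ωᴴ * Ω)ᴴ * (1 - Ωᴴ * Ω) = 1 - Ωᴴ * Ω := by
    have : Ωᴴ * Ω * (Ωᴴ * Ω) = Ωᴴ * Ω := by
      rw [Matrix.mul_assoc, ← Matrix.mul_assoc Ω, h]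
    simp [sub_mul, mul_sub, this]
  have := (posSemidef_conjTranspose_mul_self (1 - Ωᴴ * Ω)).diag_nonneg (i := e)
  rw [hE, Matrix.sub_apply, one_apply_eq, Matrix.mul_apply] at this
  have h2 : ∑ f, Ωᴴ e f * Ω f e = ((∑ f, ‖Ω f e‖ ^ 2 : ℝ) : ℂ) := by
    push_cast
    refine Finset.sum_congr rfl fun f _ => ?_
    rw [conjTranspose_apply, ← Complex.conj_mul', starRingEnd_apply]
  rw [h2] at this
  have h3 : (0 : ℂ) ≤ ((1 - ∑ f, ‖Ω f e‖ ^ 2 : ℝ) : ℂ) := by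
    push_cast
    push_cast at this
    exact this
  have := Complex.zero_le_real.mp h3
  linarith

omit [DecidableEq ι] in
theorem partialIsometry_conjTranspose {Ω : Matrix ι ι ℂ} (h : Ω * Ωᴴ * Ω = Ω) :
    Ωᴴ * Ωᴴᴴ * Ωᴴ = Ωᴴ := by
  conv_rhs => rw [← h]
  simp only [conjTranspose_mul, conjTranspose_conjTranspose, Matrix.mul_assoc]

theorem sum_norm_sq_row_le_one {Ω : Matrix ι ι ℂ} (h : Ω * Ωᴴ * Ω = Ω) (e : ι) :
    ∑ f, ‖Ω e f‖ ^ 2 ≤ 1 := by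
  simpa using sum_norm_sq_col_le_one (partialIsometry_conjTranspose h) e

theorem re_trace_mul_partialIsometry_le {Ω ρ : Matrix ι ι ℂ} (h : Ω * Ωᴴ * Ω = Ω)
    (hρ : ρ.PosSemidef) : (ρ * Ω).trace.re ≤ ρ.trace.re := by
  obtain ⟨B, rfl⟩ := exists_eq_conjTranspose_mul_self hρ
  have hE : Ωᴴ * Ω * (Ωᴴ * Ω) = Ωᴴ * Ω := by
    rw [Matrix.mul_assoc, ← Matrix.mul_assoc Ω, h]
  have h1 := (posSemidef_self_mul_conjTranspose (B - B * Ωᴴ)).trace_nonneg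
  have h2 := (posSemidef_self_mul_conjTranspose (B - B * (Ωᴴ * Ω))).trace_nonneg
  have e1 : (B - B * Ωᴴ) * (B - B * Ωᴴ)ᴴ
      = B * Bᴴ - B * Ω * Bᴴ - (B * Ω * Bᴴ)ᴴ + B * (Ωᴴ * Ω) * Bᴴ := by
    simp only [conjTranspose_sub, conjTranspose_mul, conjTranspose_conjTranspose, sub_mul, mul_sub,
      Matrix.mul_assoc]
    abel
  have e2 : (B - B * (Ωᴴ * Ω)) * (B - B * (Ωᴴ * Ω))ᴴ = B * Bᴴ - B * (Ωᴴ * Ω) * Bᴴ := by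
    have : B * (Ωᴴ * Ω) * (B * (Ωᴴ * Ω))ᴴ = B * (Ωᴴ * Ω) * Bᴴ := by
      rw [conjTranspose_mul, conjTranspose_mul, conjTranspose_conjTranspose, ← Matrix.mul_assoc,
        Matrix.mul_assoc B, hE]
    have h3 : B * (B * (Ωᴴ * Ω))ᴴ = B * (Ωᴴ * Ω) * Bᴴ := by
      simp only [conjTranspose_mul, conjTranspose_conjTranspose, Matrix.mul_assoc]
    rw [conjTranspose_sub, sub_mul, mul_sub, mul_sub, this, h3]
    abel
  rw [e1] at h1
  rw [e2] at h2
  have h1' := (Complex.le_def.mp h1).1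
  have h2' := (Complex.le_def.mp h2).1
  simp only [trace_add, trace_sub, trace_conjTranspose, Complex.add_re, Complex.sub_re,
    Complex.zero_re, Complex.star_def, Complex.conj_re] at h1' h2'
  have h4 : (Bᴴ * B * Ω).trace = (B * Ω * Bᴴ).trace := by
    rw [trace_mul_comm (B * Ω), Matrix.mul_assoc]
  rw [h4, trace_mul_comm Bᴴ B]
  linarith

/-- Two states are at trace-norm distance at most two. -/
theorem traceNorm_sub_le_two {ρ σ : Matrix ι ι ℂ} (hρ : IsState ρ) (hσ : IsState σ) :
    traceNorm (ρ - σ) ≤ 2 := by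
  obtain ⟨Ω, hΩ, h⟩ := exists_partialIsometry_trace_mul_eq_traceNorm (ρ - σ)
  have h1 := re_trace_mul_partialIsometry_le hΩ hρ.posSemidef
  have h2 := re_trace_mul_partialIsometry_le (Ω := -Ω) (by simpa using hΩ) hσ.posSemidef
  rw [hρ.trace_eq_one] at h1
  rw [hσ.trace_eq_one, Matrix.mul_neg, trace_neg, Complex.neg_re] at h2
  have h3 := congrArg Complex.re h
  rw [sub_mul, trace_sub, Complex.sub_re, Complex.ofReal_re] at h3
  norm_num at h1 h2
  linarith

theorem traceNorm_zero : traceNorm (0 : Matrix ι ι ℂ) = 0 := by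
  obtain ⟨Ω, -, h⟩ := exists_partialIsometry_trace_mul_eq_traceNorm (0 : Matrix ι ι ℂ)
  simpa using h.symm

end TraceNorm

/-! ### Expectation values of product operators -/

section Expect

variable {V : Type*} [Fintype V] [DecidableEq V] {d : ℕ}

theorem tensor_mul (A B : V → Matrix (Fin d) (Fin d) ℂ) :
    tensor A * tensor B = tensor fun i => A i * B i := by
  ext x y
  simp only [mul_apply, tensor, ← Finset.prod_mul_distrib]
  rw [Finset.prod_univ_sum, Fintype.piFinset_univ]

omit [DecidableEq V] in
theorem tensor_conjTranspose (A : V → Matrix (Fin d) (Fin d) ℂ) :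
    (tensor A)ᴴ = tensor fun i => (A i)ᴴ := by
  ext x y
  simp [tensor, conjTranspose_apply]

theorem trace_tensor (A : V → Matrix (Fin d) (Fin d) ℂ) :
    (tensor A).trace = ∏ i, (A i).trace := by
  simp only [trace, diag_apply, tensor]
  rw [Finset.prod_univ_sum, Fintype.piFinset_univ]

theorem tensor_posSemidef {A : V → Matrix (Fin d) (Fin d) ℂ} (hA : ∀ i, (A i).PosSemidef) :
    (tensor A).PosSemidef := by
  choose B hB using fun i => exists_eq_conjTranspose_mul_self (hA i)
  have : tensor A = (tensor B)ᴴ * tensor B := by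
    rw [tensor_conjTranspose, tensor_mul]; congr 1; ext1 i; exact hB i
  rw [this]
  exact posSemidef_conjTranspose_mul_self _

theorem trace_mul_nonneg {ι : Type*} [Fintype ι] {A B : Matrix ι ι ℂ} (hA : A.PosSemidef)
    (hB : B.PosSemidef) : 0 ≤ (A * B).trace := by
  classical
  obtain ⟨C, rfl⟩ := exists_eq_conjTranspose_mul_self hB
  rw [← Matrix.mul_assoc, trace_mul_comm, ← Matrix.mul_assoc]
  exact (hA.mul_mul_conjTranspose_same C).trace_nonneg

theorem tensor_update_apply (A : V → Matrix (Fin d) (Fin d) ℂ) (i : V)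
    (B : Matrix (Fin d) (Fin d) ℂ) (x y : V → Fin d) :
    tensor (Function.update A i B) x y
      = B (x i) (y i) * ∏ k ∈ Finset.univ \ {i}, A k (x k) (y k) := by
  rw [tensor, ← Finset.prod_update_of_mem (Finset.mem_univ i) (fun k => A k (x k) (y k))]
  refine Finset.prod_congr rfl fun k _ => ?_
  rcases eq_or_ne k i with rfl | h <;> simp [*]

/-- The expectation value `tr (ρ ⊗ᵢ Aᵢ)` of a product of local operators, as a multilinear function
of those operators. -/
def expect (ρ : Matrix (V → Fin d) (V → Fin d) ℂ) :
    MultilinearMap ℂ (fun _ : V => Matrix (Fin d) (Fin d) ℂ) ℂ :=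
  MultilinearMap.mk' (fun A => (ρ * tensor A).trace)
    (fun A i B C => by
      rw [← trace_add, ← mul_add]
      congr 2
      ext x y
      simp only [Matrix.add_apply, tensor_update_apply, add_mul])
    (fun A i c B => by
      rw [← trace_smul, ← mul_smul_comm]
      congr 2
      ext x y
      simp only [Matrix.smul_apply, tensor_update_apply, smul_eq_mul, mul_assoc])

theorem expect_apply (ρ : Matrix (V → Fin d) (V → Fin d) ℂ) (A : V → Matrix (Fin d) (Fin d) ℂ) :
    expect ρ A = (ρ * tensor A).trace := rfl

theorem expect_nonneg {ρ : Matrix (V → Fin d) (V → Fin d) ℂ} (hρ : ρ.PosSemidef)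
    {A : V → Matrix (Fin d) (Fin d) ℂ} (hA : ∀ i, (A i).PosSemidef) : 0 ≤ expect ρ A :=
  trace_mul_nonneg hρ (tensor_posSemidef hA)

theorem star_expect {ρ : Matrix (V → Fin d) (V → Fin d) ℂ} (hρ : ρ.IsHermitian)
    (A : V → Matrix (Fin d) (Fin d) ℂ) : star (expect ρ A) = expect ρ fun i => (A i)ᴴ := by
  rw [expect_apply, ← trace_conjTranspose, conjTranspose_mul, tensor_conjTranspose, hρ.eq,
    trace_mul_comm, expect_apply]

theorem expect_tensor (τ A : V → Matrix (Fin d) (Fin d) ℂ) :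
    expect (tensor τ) A = ∏ i, (τ i * A i).trace := by
  rw [expect_apply, tensor_mul, trace_tensor]

theorem expect_one (ρ : Matrix (V → Fin d) (V → Fin d) ℂ) : expect ρ 1 = ρ.trace := by
  have : tensor (1 : V → Matrix (Fin d) (Fin d) ℂ) = 1 := by
    ext x y
    simp [tensor, one_apply, Finset.prod_ite_zero, funext_iff]
  rw [expect_apply, this, mul_one]

/-- The product operator whose expectation values are the matrix entries of the reduction
to `S`. -/
def entryOp (S : Finset V) (a b : {i // i ∈ S} → Fin d) : V → Matrix (Fin d) (Fin d) ℂ :=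
  fun k => if h : k ∈ S then single (b ⟨k, h⟩) (a ⟨k, h⟩) 1 else 1

omit [Fintype V] in
theorem glue_apply_mem (S : Finset V) (a : {i // i ∈ S} → Fin d) (z : {i // i ∉ S} → Fin d)
    (k : {i // i ∈ S}) : glue S a z k = a k := by
  simp [glue, Equiv.piEquivPiSubtypeProd, k.2]

omit [Fintype V] in
theorem glue_apply_not_mem (S : Finset V) (a : {i // i ∈ S} → Fin d) (z : {i // i ∉ S} → Fin d)
    (k : {i // i ∉ S}) : glue S a z k = z k := by
  simp [glue, Equiv.piEquivPiSubtypeProd, k.2]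

theorem tensor_entryOp_glue (S : Finset V) (a b a' b' : {i // i ∈ S} → Fin d)
    (z z' : {i // i ∉ S} → Fin d) :
    tensor (entryOp S a b) (glue S b' z') (glue S a' z)
      = if b' = b ∧ a' = a ∧ z' = z then 1 else 0 := by
  have h1 : ∏ k : {i // i ∈ S}, entryOp S a b k (glue S b' z' k) (glue S a' z k)
      = if b' = b ∧ a' = a then 1 else 0 := by
    have : ∀ k : {i // i ∈ S}, entryOp S a b k (glue S b' z' k) (glue S a' z k)
        = if b' k = b k ∧ a' k = a k then 1 else 0 := fun k => by
      simp only [glue_apply_mem, entryOp, k.2, dif_pos, single_apply, Subtype.coe_eta, eq_comm]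
    simp only [this, Finset.prod_ite_zero, Finset.mem_univ, forall_true_left, Finset.prod_const_one,
      forall_and, funext_iff]
  have h2 : ∏ k : {i // i ∉ S}, entryOp S a b k (glue S b' z' k) (glue S a' z k)
      = if z' = z then 1 else 0 := by
    have : ∀ k : {i // i ∉ S}, entryOp S a b k (glue S b' z' k) (glue S a' z k)
        = if z' k = z k then 1 else 0 := fun k => by
      simp only [glue_apply_not_mem, entryOp, k.2, dif_neg, not_false_eq_true, one_apply]
    simp only [this, Finset.prod_ite_zero, Finset.mem_univ, forall_true_left, Finset.prod_const_one,
      funext_iff]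
  have h0 := Fintype.prod_subtype_mul_prod_subtype (fun i => i ∈ S)
    (fun k => entryOp S a b k (glue S b' z' k) (glue S a' z k))
  rw [tensor, ← h0]
  refine Eq.trans (congrArg₂ (· * ·) (Eq.trans (by congr!) h1) h2) ?_
  clear h0 h1 h2
  simp only [← and_assoc]
  split_ifs <;> simp_all

theorem reduce_apply_eq_expect (S : Finset V) (ρ : Matrix (V → Fin d) (V → Fin d) ℂ)
    (a b : {i // i ∈ S} → Fin d) : reduce S ρ a b = expect ρ (entryOp S a b) := by
  have e : ∀ f : (V → Fin d) → ℂ, ∑ x, f x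
      = ∑ a' : {i // i ∈ S} → Fin d, ∑ z : {i // i ∉ S} → Fin d, f (glue S a' z) := fun f => by
    rw [← Fintype.sum_prod_type']
    exact (Equiv.sum_comp (Equiv.piEquivPiSubtypeProd (fun i => i ∈ S) (fun _ => Fin d)).symm
      f).symm
  simp only [expect_apply, trace, diag_apply, mul_apply]
  simp only [e, tensor_entryOp_glue]
  simp only [ite_and, mul_ite, mul_one, mul_zero, Finset.sum_ite_eq',
    Finset.mem_univ, if_true, Finset.sum_const_zero, Finset.sum_ite_irrel]
  simp [reduce]

/-- The unnormalised state of site `i` once the product operator `A` has been applied to the other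
sites: the matrix representing the functional `B ↦ tr (ρ (B ⊗ ⨂_{k ≠ i} A k))`. -/
def marg (ρ : Matrix (V → Fin d) (V → Fin d) ℂ) (A : V → Matrix (Fin d) (Fin d) ℂ) (i : V) :
    Matrix (Fin d) (Fin d) ℂ :=
  of fun a b => expect ρ (Function.update A i (single b a 1))

theorem trace_marg_mul (ρ : Matrix (V → Fin d) (V → Fin d) ℂ) (A : V → Matrix (Fin d) (Fin d) ℂ)
    (i : V) (B : Matrix (Fin d) (Fin d) ℂ) :
    (marg ρ A i * B).trace = expect ρ (Function.update A i B) := by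
  conv_rhs => rw [matrix_eq_sum_single B]
  simp only [MultilinearMap.map_update_sum]
  rw [Finset.sum_comm]
  simp only [trace, diag_apply, mul_apply]
  refine Finset.sum_congr rfl fun a _ => Finset.sum_congr rfl fun b _ => ?_
  rw [← mul_one (B b a), ← smul_eq_mul (B b a), ← smul_single, MultilinearMap.map_update_smul]
  simp [marg, mul_comm]

theorem trace_marg (ρ : Matrix (V → Fin d) (V → Fin d) ℂ) (A : V → Matrix (Fin d) (Fin d) ℂ)
    (i : V) : (marg ρ A i).trace = expect ρ (Function.update A i 1) := by
  rw [← trace_marg_mul, mul_one]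

theorem marg_posSemidef {ρ : Matrix (V → Fin d) (V → Fin d) ℂ} (hρ : ρ.PosSemidef)
    {A : V → Matrix (Fin d) (Fin d) ℂ} (hA : ∀ i, (A i).PosSemidef) (i : V) :
    (marg ρ A i).PosSemidef := by
  refine .of_dotProduct_mulVec_nonneg ?_ fun v => ?_
  · ext a b
    rw [conjTranspose_apply, marg, of_apply, of_apply, star_expect hρ.isHermitian]
    congr 1
    ext1 k
    rcases eq_or_ne k i with rfl | h
    · simp [conjTranspose_single]
    · simp [h, (hA k).isHermitian.eq]
  · have : star v ⬝ᵥ (marg ρ A i *ᵥ v) = (marg ρ A i * vecMulVec v (star v)).trace := by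
      rw [mul_vecMulVec, trace_vecMulVec, dotProduct_comm]
    rw [this, trace_marg_mul]
    refine expect_nonneg hρ fun k => ?_
    rcases eq_or_ne k i with rfl | h
    · simpa using posSemidef_vecMulVec_self_star v
    · simpa [h] using hA k

/-- The (unnormalised) channel from operators on site `j` to states of site `i` defined by the
two-site marginal of `ρ`, with `A` applied to the remaining sites. -/
def pairMap (ρ : Matrix (V → Fin d) (V → Fin d) ℂ) (A : V → Matrix (Fin d) (Fin d) ℂ) (i j : V) :
    Matrix (Fin d) (Fin d) ℂ →ₗ[ℂ] Matrix (Fin d) (Fin d) ℂ where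
  toFun B := of fun a b =>
    expect ρ (Function.update (Function.update A i (single b a 1)) j B)
  map_add' B C := by ext a b; simp
  map_smul' c B := by ext a b; simp

theorem pairMap_eq_marg (ρ : Matrix (V → Fin d) (V → Fin d) ℂ)
    (A : V → Matrix (Fin d) (Fin d) ℂ) {i j : V} (h : i ≠ j) (B : Matrix (Fin d) (Fin d) ℂ) :
    pairMap ρ A i j B = marg ρ (Function.update A j B) i := by
  ext a b
  simp only [pairMap, LinearMap.coe_mk, AddHom.coe_mk, of_apply, marg]
  rw [Function.update_comm h]

end Expect

/-! ### Weighted purity and its increase under a measurement -/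

section Purity

variable {ι κ : Type*} [Fintype ι] [Fintype κ]

/-- The squared Frobenius (Hilbert–Schmidt) norm. -/
def frobSq (A : Matrix ι ι ℂ) : ℝ := ∑ a, ∑ b, ‖A a b‖ ^ 2

/-- The purity `tr (τ²)` of the state `τ = A / tr A`, weighted by the probability `tr A` of its
occurrence, for a positive semidefinite `A`. The convention `0 / 0 = 0` is the right one for an
outcome of probability zero. -/
def purity (A : Matrix ι ι ℂ) : ℝ := frobSq A / A.trace.re

theorem frobSq_nonneg (A : Matrix ι ι ℂ) : 0 ≤ frobSq A := by unfold frobSq; positivity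

theorem frobSq_zero : frobSq (0 : Matrix ι ι ℂ) = 0 := by simp [frobSq]

theorem ofReal_re_trace {A : Matrix ι ι ℂ} (hA : A.PosSemidef) :
    ((A.trace.re : ℝ) : ℂ) = A.trace :=
  (Complex.eq_re_of_ofReal_le hA.trace_nonneg).symm

theorem re_trace_nonneg {A : Matrix ι ι ℂ} (hA : A.PosSemidef) : 0 ≤ A.trace.re :=
  (Complex.le_def.mp hA.trace_nonneg).1

theorem frobSq_le_sq_trace {A : Matrix ι ι ℂ} (hA : A.PosSemidef) :
    frobSq A ≤ A.trace.re ^ 2 := by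
  classical
  obtain ⟨B, rfl⟩ := exists_eq_conjTranspose_mul_self hA
  have htr : (Bᴴ * B).trace.re = ∑ a, ∑ k, ‖B k a‖ ^ 2 := by
    simp only [trace, diag_apply, mul_apply, conjTranspose_apply, Complex.re_sum]
    refine Finset.sum_congr rfl fun a _ => Finset.sum_congr rfl fun k _ => ?_
    rw [Complex.star_def, Complex.conj_mul', ← Complex.ofReal_pow, Complex.ofReal_re]
  rw [htr, sq, Finset.sum_mul_sum, frobSq]
  refine Finset.sum_le_sum fun a _ => Finset.sum_le_sum fun b _ => ?_
  calc ‖(Bᴴ * B) a b‖ ^ 2 ≤ (∑ k, ‖B k a‖ * ‖B k b‖) ^ 2 := by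
        gcongr
        rw [mul_apply]
        refine (norm_sum_le _ _).trans (le_of_eq ?_)
        simp
    _ ≤ _ := Finset.sum_mul_sq_le_sq_mul_sq _ _ _

theorem purity_nonneg {A : Matrix ι ι ℂ} (hA : A.PosSemidef) : 0 ≤ purity A :=
  div_nonneg (frobSq_nonneg A) (re_trace_nonneg hA)

theorem purity_le_trace {A : Matrix ι ι ℂ} (hA : A.PosSemidef) : purity A ≤ A.trace.re := by
  rcases (re_trace_nonneg hA).eq_or_lt with h | h
  · rw [purity, ← h, div_zero]
  · rw [purity, div_le_iff₀ h, ← sq]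
    exact frobSq_le_sq_trace hA

theorem eq_zero_of_re_trace_eq_zero {A : Matrix ι ι ℂ} (hA : A.PosSemidef)
    (h : A.trace.re = 0) : A = 0 := by
  have h1 := frobSq_le_sq_trace hA
  rw [h] at h1
  have h2 : frobSq A = 0 := le_antisymm (by simpa using h1) (frobSq_nonneg A)
  ext a b
  have h3 := (Finset.sum_eq_zero_iff_of_nonneg (fun a _ => by positivity)).mp h2 a
    (Finset.mem_univ _)
  have h4 := (Finset.sum_eq_zero_iff_of_nonneg (fun b _ => by positivity)).mp h3 b
    (Finset.mem_univ _)
  simpa using h4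

/-- Variance identity: if an ensemble of unnormalised states `A y` averages to `∑ y, A y`, the
increase of purity is the mean squared deviation from the average state. -/
theorem sum_purity_sub_purity {A : κ → Matrix ι ι ℂ} (hA : ∀ y, (A y).PosSemidef)
    {S : Matrix ι ι ℂ} (hS : ∑ y, A y = S) :
    ∑ y, purity (A y) - purity S
      = ∑ y, frobSq (A y - ((A y).trace / S.trace) • S) / (A y).trace.re := by
  have hSp : S.PosSemidef := hS ▸ posSemidef_sum _ fun y _ => hA y
  set p : κ → ℝ := fun y => (A y).trace.re with hp
  set q : ℝ := S.trace.re with hq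
  have hpq : ∑ y, p y = q := by
    rw [hq, ← hS, trace_sum, Complex.re_sum]
  have key : ∀ y, frobSq (A y - ((A y).trace / S.trace) • S) / p y
      = purity (A y) - 2 / q * (∑ a, ∑ b, (A y a b * star (S a b)).re)
        + p y / q ^ 2 * frobSq S := fun y => by
    rcases eq_or_ne (p y) 0 with h | h
    · -- For an outcome of probability zero every term is zero.
      rw [eq_zero_of_re_trace_eq_zero (hA y) h]
      simp [purity, h]
    · have e : ∀ a b, ‖(A y - ((A y).trace / S.trace) • S) a b‖ ^ 2
          = ‖A y a b‖ ^ 2 - 2 * (p y / q) * (A y a b * star (S a b)).re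
            + (p y / q) ^ 2 * ‖S a b‖ ^ 2 := fun a b => by
        rw [← ofReal_re_trace (hA y), ← ofReal_re_trace hSp, ← Complex.ofReal_div]
        simp only [← Complex.normSq_eq_norm_sq, Complex.normSq_apply, Matrix.sub_apply,
          Matrix.smul_apply, smul_eq_mul, Complex.sub_re, Complex.sub_im, Complex.mul_re,
          Complex.mul_im, Complex.ofReal_re, Complex.ofReal_im, Complex.star_def, Complex.conj_re,
          Complex.conj_im]
        ring
      simp only [frobSq, purity, e, Finset.sum_add_distrib, Finset.sum_sub_distrib,
        ← Finset.mul_sum]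
      change _ = _ / p y - _ + _
      field_simp
  refine Eq.trans ?_ (Finset.sum_congr rfl fun y _ => key y).symm
  simp only [Finset.sum_add_distrib, Finset.sum_sub_distrib, ← Finset.mul_sum,
    ← Finset.sum_mul, ← Finset.sum_div, hpq]
  have h2 : ∑ y, ∑ a, ∑ b, (A y a b * star (S a b)).re = frobSq S := by
    rw [Finset.sum_comm]
    refine Finset.sum_congr rfl fun a _ => ?_
    rw [Finset.sum_comm]
    refine Finset.sum_congr rfl fun b _ => ?_
    rw [← Complex.re_sum, ← Finset.sum_mul, ← Matrix.sum_apply, hS, Complex.star_def,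
      Complex.mul_conj', ← Complex.ofReal_pow, Complex.ofReal_re]
  rw [h2]
  change _ - frobSq S / q = _
  rcases eq_or_ne q 0 with h | h
  · simp [h]
  · field_simp
    ring

end Purity

/-! ### An informationally complete measurement -/

section Measurement

variable {d : ℕ}

/-- The vector `|k⟩ + iˢ |l⟩`. -/
def pairVec (k l : Fin d) (s : Fin 4) : Fin d → ℂ :=
  Pi.single k 1 + Complex.I ^ (s : ℕ) • Pi.single l 1

/-- The measurement with outcomes `(k, l, s)` whose elements are the rank-one operators
`|v⟩⟨v| / (8 d)` with `v = |k⟩ + iˢ |l⟩`. The outcomes `k = l` are kept: they make the elements sum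
to the identity without a case distinction. -/
def povm (y : Fin d × Fin d × Fin 4) : Matrix (Fin d) (Fin d) ℂ :=
  ((1 / (8 * d) : ℝ) : ℂ) • vecMulVec (pairVec y.1 y.2.1 y.2.2) (star (pairVec y.1 y.2.1 y.2.2))

theorem povm_posSemidef (y : Fin d × Fin d × Fin 4) : (povm y).PosSemidef :=
  (posSemidef_vecMulVec_self_star _).smul (by
    rw [Complex.zero_le_real]; positivity)

theorem povm_eq (k l : Fin d) (s : Fin 4) :
    povm (k, l, s) = ((1 / (8 * d) : ℝ) : ℂ) • (single k k 1 + single l l 1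
      + Complex.I ^ (s : ℕ) • single l k 1 + (-Complex.I) ^ (s : ℕ) • single k l 1) := by
  have hI : (-Complex.I) ^ (s : ℕ) * Complex.I ^ (s : ℕ) = 1 := by
    rw [← mul_pow]; simp
  have h1 : ∀ m n : Fin d, vecMulVec (Pi.single m (1 : ℂ)) (Pi.single n (1 : ℂ)) = single m n 1 :=
    fun m n => by
      ext a b
      simp only [vecMulVec_apply, Pi.single_apply, single_apply, mul_ite, mul_one, mul_zero,
        ite_and, eq_comm]
      split_ifs <;> rfl
  rw [povm, pairVec]
  congr 1
  have h2 : star (Pi.single k (1 : ℂ) + Complex.I ^ (s : ℕ) • Pi.single l (1 : ℂ) : Fin d → ℂ)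
      = Pi.single k 1 + (-Complex.I) ^ (s : ℕ) • Pi.single l 1 := by
    ext m
    simp [Pi.single_apply, apply_ite (starRingEnd ℂ)]
  rw [h2]
  simp only [add_vecMulVec, vecMulVec_add, smul_vecMulVec, vecMulVec_smul, h1, smul_smul,
    hI, one_smul, smul_add]
  abel

theorem sum_povm [NeZero d] : ∑ y, povm (d := d) y = 1 := by
  have hd : (d : ℂ) ≠ 0 := Nat.cast_ne_zero.mpr (NeZero.ne d)
  have h1 : ∀ k l : Fin d, ∑ s, povm (k, l, s)
      = ((1 / (2 * d) : ℝ) : ℂ) • (single k k 1 + single l l 1) := fun k l => by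
    simp only [povm_eq, Fin.sum_univ_four]
    ext a b
    simp only [Matrix.add_apply, Matrix.smul_apply, smul_eq_mul, Fin.val_zero, Fin.val_one,
      Fin.val_two, show ((3 : Fin 4) : ℕ) = 3 from rfl, pow_zero, pow_one, Complex.I_sq,
      Complex.I_pow_three, neg_sq, Odd.neg_pow (show Odd 3 by decide)]
    push_cast
    field_simp
    ring
  have h2 : ∑ k : Fin d, single k k (1 : ℂ) = 1 := sum_single_one
  rw [Fintype.sum_prod_type]
  simp only [Fintype.sum_prod_type, h1, ← Finset.smul_sum, Finset.sum_add_distrib, h2,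
    Finset.sum_const, Finset.card_univ, Fintype.card_fin]
  rw [← Nat.cast_smul_eq_nsmul ℂ, ← add_smul, smul_smul]
  convert one_smul ℂ (1 : Matrix (Fin d) (Fin d) ℂ) using 2
  push_cast
  field_simp
  norm_num

/-- Fourier analysis on `ℤ/4`: the frequencies `0`, `1` and `-1` are orthogonal. -/
theorem sum_frobSq_four {ι : Type*} [Fintype ι] (A B C : Matrix ι ι ℂ) :
    ∑ s : Fin 4, frobSq (A + Complex.I ^ (s : ℕ) • B + (-Complex.I) ^ (s : ℕ) • C)
      = 4 * (frobSq A + frobSq B + frobSq C) := by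
  have e : ∀ x y z : ℂ, ∑ s : Fin 4, ‖x + Complex.I ^ (s : ℕ) * y + (-Complex.I) ^ (s : ℕ) * z‖ ^ 2
      = 4 * (‖x‖ ^ 2 + ‖y‖ ^ 2 + ‖z‖ ^ 2) := fun x y z => by
    simp only [Fin.sum_univ_four, Fin.val_zero, Fin.val_one, Fin.val_two,
      show ((3 : Fin 4) : ℕ) = 3 from rfl, pow_zero, pow_one, Complex.I_sq, Complex.I_pow_three,
      neg_sq, Odd.neg_pow (show Odd 3 by decide), ← Complex.normSq_eq_norm_sq,
      Complex.normSq_apply, Complex.add_re, Complex.add_im, Complex.mul_re, Complex.mul_im,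
      Complex.neg_re, Complex.neg_im, Complex.I_re, Complex.I_im, Complex.one_re, Complex.one_im]
    ring
  simp only [frobSq]
  rw [Finset.sum_comm]
  simp only [← Finset.sum_add_distrib, Finset.mul_sum]
  refine Finset.sum_congr rfl fun a _ => ?_
  rw [Finset.sum_comm]
  refine Finset.sum_congr rfl fun b _ => ?_
  simpa using e (A a b) (B a b) (C a b)

theorem frobSq_smul {ι : Type*} [Fintype ι] (c : ℝ) (A : Matrix ι ι ℂ) :
    frobSq ((c : ℂ) • A) = c ^ 2 * frobSq A := by
  simp [frobSq, Finset.mul_sum, mul_pow]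

/-- The part of a map that survives after subtracting its product approximation
`B ↦ tr (F B) / tr (F 1) • F 1`; it vanishes when `F` comes from a product state. -/
def correl (F : Matrix (Fin d) (Fin d) ℂ →ₗ[ℂ] Matrix (Fin d) (Fin d) ℂ) :
    Matrix (Fin d) (Fin d) ℂ →ₗ[ℂ] Matrix (Fin d) (Fin d) ℂ where
  toFun B := F B - ((F B).trace / (F 1).trace) • F 1
  map_add' B C := by simp only [map_add, trace_add, add_div, add_smul]; abel
  map_smul' c B := by
    simp only [map_smul, trace_smul, smul_eq_mul, RingHom.id_apply, smul_sub, smul_smul,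
      mul_div_assoc]

theorem correl_apply (F : Matrix (Fin d) (Fin d) ℂ →ₗ[ℂ] Matrix (Fin d) (Fin d) ℂ)
    (B : Matrix (Fin d) (Fin d) ℂ) :
    correl F B = F B - ((F B).trace / (F 1).trace) • F 1 := rfl

/-- The mean increase of the purity of `F 1` when the measurement is carried out on the input
side of `F`. -/
def purityGain (F : Matrix (Fin d) (Fin d) ℂ →ₗ[ℂ] Matrix (Fin d) (Fin d) ℂ) : ℝ :=
  ∑ y, purity (F (povm y)) - purity (F 1)

variable {F : Matrix (Fin d) (Fin d) ℂ →ₗ[ℂ] Matrix (Fin d) (Fin d) ℂ}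

theorem purityGain_eq [NeZero d] (hF : ∀ B, B.PosSemidef → (F B).PosSemidef) :
    purityGain F = ∑ y, frobSq (correl F (povm y)) / (F (povm y)).trace.re :=
  sum_purity_sub_purity (fun y => hF _ (povm_posSemidef y)) (by rw [← map_sum, sum_povm])

theorem purityGain_nonneg [NeZero d] (hF : ∀ B, B.PosSemidef → (F B).PosSemidef) :
    0 ≤ purityGain F := by
  rw [purityGain_eq hF]
  exact Finset.sum_nonneg fun y _ => div_nonneg (frobSq_nonneg _)
    (re_trace_nonneg (hF _ (povm_posSemidef y)))

theorem single_posSemidef (k : Fin d) : (single k k (1 : ℂ)).PosSemidef := by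
  have := PosSemidef.diagonal (d := (Pi.single k (1 : ℂ) : Fin d → ℂ))
    (Pi.single_nonneg.mpr zero_le_one)
  rwa [diagonal_single] at this

/-- An outcome `(k, l, s)` and its opposite `(k, l, s + 2)` together have probability
proportional to that of finding the site in `|k⟩` or `|l⟩`. -/
theorem re_trace_povm_le (hF : ∀ B, B.PosSemidef → (F B).PosSemidef) (k l : Fin d) (s : Fin 4) :
    (F (povm (k, l, s))).trace.re
      ≤ 1 / (4 * d) * ((F (single k k 1)).trace.re + (F (single l l 1)).trace.re) := by
  have hI : Complex.I ^ ((s + 2 : Fin 4) : ℕ) = -Complex.I ^ (s : ℕ) ∧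
      (-Complex.I) ^ ((s + 2 : Fin 4) : ℕ) = -(-Complex.I) ^ (s : ℕ) := by
    fin_cases s <;> simp [pow_succ]
  have h1 : povm (k, l, s) + povm (k, l, s + 2)
      = ((1 / (4 * d) : ℝ) : ℂ) • (single k k 1 + single l l 1) := by
    rw [povm_eq, povm_eq, hI.1, hI.2, ← smul_add, neg_smul, neg_smul,
      show ((1 / (4 * d) : ℝ) : ℂ) = ((1 / (8 * d) : ℝ) : ℂ) * 2 by push_cast; ring, mul_smul]
    congr 1
    rw [two_smul]
    abel
  have h2 := congrArg (fun B => (F B).trace.re) h1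
  simp only [map_add, map_smul, trace_add, trace_smul, Complex.add_re, smul_eq_mul,
    Complex.re_ofReal_mul] at h2
  rw [← h2]
  have := re_trace_nonneg (hF _ (povm_posSemidef (k, l, s + 2)))
  linarith

/-- The squared Frobenius norm of a block of the correlation, relative to the probability of
finding the site in `|k⟩` or `|l⟩`, is controlled by the purity gain of the outcomes `(k, l, ·)`. -/
theorem frobSq_correl_single_le [NeZero d] (hF : ∀ B, B.PosSemidef → (F B).PosSemidef)
    (k l : Fin d) :
    frobSq (correl F (single l k 1))
      ≤ ((F (single k k 1)).trace.re + (F (single l l 1)).trace.re) *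
        (4 * d * ∑ s, frobSq (correl F (povm (k, l, s))) / (F (povm (k, l, s))).trace.re) := by
  have hd : (0 : ℝ) < d := Nat.cast_pos.mpr (NeZero.pos d)
  set r := (F (single k k 1)).trace.re + (F (single l l 1)).trace.re with hr
  set I := ∑ s, frobSq (correl F (povm (k, l, s))) / (F (povm (k, l, s))).trace.re with hI
  have h1 : ∑ s, frobSq (correl F (povm (k, l, s))) = (1 / (8 * d)) ^ 2 *
      (4 * (frobSq (correl F (single k k 1 + single l l 1)) + frobSq (correl F (single l k 1))
        + frobSq (correl F (single k l 1)))) := by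
    rw [← sum_frobSq_four, Finset.mul_sum]
    refine Finset.sum_congr rfl fun s _ => ?_
    rw [povm_eq, map_smul, frobSq_smul, map_add, map_add, map_smul, map_smul]
  have h2 : ∑ s, frobSq (correl F (povm (k, l, s))) ≤ 1 / (4 * d) * r * I := by
    rw [hI, Finset.mul_sum]
    refine Finset.sum_le_sum fun s _ => ?_
    have hpos := hF _ (povm_posSemidef (k, l, s))
    rcases (re_trace_nonneg hpos).eq_or_lt with h | h
    · -- An outcome of probability zero contributes `0 / 0 = 0`, and its deviation vanishes as well.
      rw [← h, div_zero, mul_zero, correl_apply, eq_zero_of_re_trace_eq_zero hpos h.symm]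
      simp [frobSq_zero]
    · calc frobSq (correl F (povm (k, l, s)))
          = (F (povm (k, l, s))).trace.re *
            (frobSq (correl F (povm (k, l, s))) / (F (povm (k, l, s))).trace.re) := by
            field_simp
        _ ≤ _ := mul_le_mul_of_nonneg_right (re_trace_povm_le hF k l s)
            (div_nonneg (frobSq_nonneg _) h.le)
  rw [h1] at h2
  have h3 := frobSq_nonneg (correl F (single k k 1 + single l l 1))
  have h4 := frobSq_nonneg (correl F (single k l 1))
  have h5 : (1 / (8 * (d : ℝ))) ^ 2 * (4 * frobSq (correl F (single l k 1)))
      ≤ 1 / (4 * d) * r * I := by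
    refine le_trans ?_ h2
    gcongr
    linarith
  have h6 := mul_le_mul_of_nonneg_left h5 (show 0 ≤ 16 * (d : ℝ) ^ 2 by positivity)
  calc _ = 16 * (d : ℝ) ^ 2 * ((1 / (8 * (d : ℝ))) ^ 2 * (4 * frobSq (correl F (single l k 1)))) := by
        field_simp; ring
    _ ≤ _ := h6
    _ = _ := by field_simp; norm_num

/-- Cauchy–Schwarz followed by the inequality of arithmetic and geometric means, in a form that
allows `g = 0`. -/
theorem norm_sum_mul_le {ι : Type*} [Fintype ι] (A B : Matrix ι ι ℂ) {g h t : ℝ} (ht : 0 < t)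
    (hg : 0 ≤ g) (hh : 0 ≤ h) (hA : frobSq A ≤ g * h) :
    ‖∑ a, ∑ b, A a b * B a b‖ ≤ (t * (g * frobSq B) + h / t) / 2 := by
  have h1 : ‖∑ a, ∑ b, A a b * B a b‖ ^ 2 ≤ frobSq A * frobSq B := by
    simp only [frobSq, ← Fintype.sum_prod_type']
    refine le_trans ?_ (Finset.sum_mul_sq_le_sq_mul_sq Finset.univ
      (fun x : ι × ι => ‖A x.1 x.2‖) (fun x => ‖B x.1 x.2‖))
    gcongr
    refine (norm_sum_le _ _).trans (le_of_eq ?_)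
    simp
  have hB := frobSq_nonneg B
  refine abs_le_of_sq_le_sq' ?_ (by positivity) |>.2
  calc _ ≤ g * h * frobSq B := h1.trans (by gcongr)
    _ = (t * (g * frobSq B)) * (h / t) := by field_simp
    _ ≤ _ := by nlinarith [sq_nonneg (t * (g * frobSq B) - h / t)]

/-- The pairing of the correlation with a block matrix `ω` whose block rows and columns have squared
Frobenius norm at most `d` is controlled by the purity gain. -/
theorem norm_sum_correl_mul_le [NeZero d] (hF : ∀ B, B.PosSemidef → (F B).PosSemidef)
    (ω : Fin d → Fin d → Matrix (Fin d) (Fin d) ℂ) (hcol : ∀ k, ∑ l, frobSq (ω k l) ≤ d)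
    (hrow : ∀ l, ∑ k, frobSq (ω k l) ≤ d) {t : ℝ} (ht : 0 < t) :
    ‖∑ k, ∑ l, ∑ a, ∑ b, correl F (single l k 1) a b * ω k l a b‖
      ≤ d * (t * (F 1).trace.re + 2 * purityGain F / t) := by
  set r : Fin d → ℝ := fun k => (F (single k k 1)).trace.re with hr
  have hr0 : ∀ k, 0 ≤ r k := fun k => re_trace_nonneg (hF _ (single_posSemidef k))
  have hrsum : ∑ k, r k = (F 1).trace.re := by
    rw [← sum_single_one, map_sum, trace_sum, Complex.re_sum]
  set I : Fin d → Fin d → ℝ := fun k l =>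
    ∑ s, frobSq (correl F (povm (k, l, s))) / (F (povm (k, l, s))).trace.re with hI
  have hI0 : ∀ k l, 0 ≤ I k l := fun k l => Finset.sum_nonneg fun s _ =>
    div_nonneg (frobSq_nonneg _) (re_trace_nonneg (hF _ (povm_posSemidef _)))
  have hIsum : ∑ k, ∑ l, I k l = purityGain F := by
    rw [purityGain_eq hF, Fintype.sum_prod_type]
    simp only [Fintype.sum_prod_type, hI]
  have hw : ∑ k, ∑ l, (r k + r l) * frobSq (ω k l) ≤ 2 * d * ∑ k, r k := by
    simp only [add_mul, Finset.sum_add_distrib]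
    rw [two_mul, add_mul]
    refine add_le_add ?_ ?_
    · rw [Finset.mul_sum]
      refine Finset.sum_le_sum fun k _ => ?_
      rw [← Finset.mul_sum, mul_comm]
      exact mul_le_mul_of_nonneg_right (hcol k) (hr0 k)
    · rw [Finset.sum_comm, Finset.mul_sum]
      refine Finset.sum_le_sum fun l _ => ?_
      rw [← Finset.mul_sum, mul_comm]
      exact mul_le_mul_of_nonneg_right (hrow l) (hr0 l)
  calc _ ≤ ∑ k, ∑ l, (t * ((r k + r l) * frobSq (ω k l)) + 4 * d * I k l / t) / 2 := by
        refine (norm_sum_le _ _).trans (Finset.sum_le_sum fun k _ => ?_)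
        refine (norm_sum_le _ _).trans (Finset.sum_le_sum fun l _ => ?_)
        exact norm_sum_mul_le _ _ ht (add_nonneg (hr0 k) (hr0 l))
          (mul_nonneg (by positivity) (hI0 k l)) (frobSq_correl_single_le hF k l)
    _ = (t * ∑ k, ∑ l, (r k + r l) * frobSq (ω k l) + 4 * d * (∑ k, ∑ l, I k l) / t) / 2 := by
        simp only [Finset.mul_sum, Finset.sum_div, ← Finset.sum_add_distrib]
    _ ≤ (t * (2 * d * ∑ k, r k) + 4 * d * (∑ k, ∑ l, I k l) / t) / 2 := by gcongr
    _ = _ := by rw [hrsum, hIsum]; ring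

end Measurement

/-! ### Measuring a set of sites -/

section Conditioning

variable {V : Type*} [Fintype V] [DecidableEq V] {d : ℕ}

/-- The product operator recorded by a string `z`: the measurement element of the outcome on the
measured sites, and the identity on the sites with entry `none`, which are not measured. -/
def outcomeOp (z : V → Option (Fin d × Fin d × Fin 4)) : V → Matrix (Fin d) (Fin d) ℂ :=
  fun k => (z k).elim 1 povm

/-- The strings of outcomes of a measurement of exactly the sites in `C`. -/
def outcomes (d : ℕ) (C : Finset V) : Finset (V → Option (Fin d × Fin d × Fin 4)) :=
  Fintype.piFinset fun k => if k ∈ C then Finset.univ.map Function.Embedding.some else {none}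

theorem eq_none_of_mem_outcomes {C : Finset V} {z : V → Option (Fin d × Fin d × Fin 4)}
    (hz : z ∈ outcomes d C) {k : V} (hk : k ∉ C) : z k = none := by
  simpa [hk] using Fintype.mem_piFinset.mp hz k

theorem outcomeOp_eq_one {C : Finset V} {z : V → Option (Fin d × Fin d × Fin 4)}
    (hz : z ∈ outcomes d C) {k : V} (hk : k ∉ C) : outcomeOp z k = 1 := by
  simp [outcomeOp, eq_none_of_mem_outcomes hz hk]

omit [Fintype V] [DecidableEq V] in
theorem outcomeOp_posSemidef (z : V → Option (Fin d × Fin d × Fin 4)) (k : V) :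
    (outcomeOp z k).PosSemidef := by
  unfold outcomeOp
  cases z k with
  | none => exact PosSemidef.one
  | some y => exact povm_posSemidef y

omit [Fintype V] in
theorem outcomeOp_update (z : V → Option (Fin d × Fin d × Fin 4)) (j : V)
    (y : Fin d × Fin d × Fin 4) :
    outcomeOp (Function.update z j (some y)) = Function.update (outcomeOp z) j (povm y) := by
  ext1 k
  rcases eq_or_ne k j with rfl | h <;> simp [outcomeOp, *]

theorem sum_outcomes_insert {M : Type*} [AddCommMonoid M] {C : Finset V} {j : V} (hj : j ∉ C)
    (f : (V → Option (Fin d × Fin d × Fin 4)) → M) :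
    ∑ z ∈ outcomes d (insert j C), f z
      = ∑ z ∈ outcomes d C, ∑ y, f (Function.update z j (some y)) := by
  rw [← Finset.sum_product']
  symm
  refine Finset.sum_bij (fun p _ => Function.update p.1 j (some p.2)) ?_ ?_ ?_ fun _ _ => rfl
  · rintro ⟨z, y⟩ hz
    simp only [Finset.mem_product, Finset.mem_univ, and_true] at hz
    refine Fintype.mem_piFinset.mpr fun k => ?_
    rcases eq_or_ne k j with rfl | h
    · simp
    · simpa [h] using Fintype.mem_piFinset.mp hz k
  · rintro ⟨z, y⟩ hz ⟨z', y'⟩ hz' h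
    simp only [Finset.mem_product, Finset.mem_univ, and_true] at hz hz'
    have h1 := congrFun h j
    simp only [Function.update_self, Option.some.injEq] at h1
    refine Prod.ext (funext fun k => ?_) h1
    rcases eq_or_ne k j with rfl | hk
    · exact (eq_none_of_mem_outcomes hz hj).trans (eq_none_of_mem_outcomes hz' hj).symm
    · simpa [hk] using congrFun h k
  · intro z hz
    have h1 : ∃ y, z j = some y := by
      have := Fintype.mem_piFinset.mp hz j
      simpa [eq_comm] using this
    obtain ⟨y, hy⟩ := h1
    refine ⟨(Function.update z j none, y), ?_, ?_⟩
    · simp only [Finset.mem_product, Finset.mem_univ, and_true]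
      refine Fintype.mem_piFinset.mpr fun k => ?_
      rcases eq_or_ne k j with rfl | h
      · simp [hj]
      · simpa [h] using Fintype.mem_piFinset.mp hz k
    · ext1 k
      rcases eq_or_ne k j with rfl | h <;> simp [*]

/-- Averaging over the outcomes of the measurement of `C` does not change expectation values of
operators on a set `D` of unmeasured sites. -/
theorem sum_expect_outcomes [NeZero d] (ρ : Matrix (V → Fin d) (V → Fin d) ℂ) {C D : Finset V}
    (hCD : ∀ k ∈ D, k ∉ C) (P : V → Matrix (Fin d) (Fin d) ℂ) :
    ∑ z ∈ outcomes d C, expect ρ (fun k => if k ∈ D then P k else outcomeOp z k)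
      = expect ρ fun k => if k ∈ D then P k else 1 := by
  have h := (expect ρ).map_sum_finset
    (fun k (o : Option (Fin d × Fin d × Fin 4)) =>
      if k ∈ D then P k else (o.elim 1 povm : Matrix (Fin d) (Fin d) ℂ))
    (fun k => if k ∈ C then Finset.univ.map Function.Embedding.some else {none})
  refine h.symm.trans (congrArg _ (funext fun k => ?_))
  by_cases hD : k ∈ D
  · simp [hD, hCD k hD]
  · by_cases hC : k ∈ C
    · simp [hD, hC, sum_povm]
    · simp [hD, hC]

/-- The probability of the outcome string `z`. -/
def prob (ρ : Matrix (V → Fin d) (V → Fin d) ℂ) (z : V → Option (Fin d × Fin d × Fin 4)) : ℝ :=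
  (expect ρ (outcomeOp z)).re

variable {ρ : Matrix (V → Fin d) (V → Fin d) ℂ}

theorem prob_nonneg (hρ : ρ.PosSemidef) (z : V → Option (Fin d × Fin d × Fin 4)) :
    0 ≤ prob ρ z :=
  (Complex.le_def.mp (expect_nonneg hρ (outcomeOp_posSemidef z))).1

theorem ofReal_prob (hρ : ρ.PosSemidef) (z : V → Option (Fin d × Fin d × Fin 4)) :
    (prob ρ z : ℂ) = expect ρ (outcomeOp z) :=
  (Complex.eq_re_of_ofReal_le (expect_nonneg hρ (outcomeOp_posSemidef z))).symm

theorem sum_prob [NeZero d] (hρ : IsState ρ) (C : Finset V) : ∑ z ∈ outcomes d C, prob ρ z = 1 := by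
  have h := sum_expect_outcomes ρ (C := C) (D := ∅) (by simp) 1
  simp only [Finset.notMem_empty, if_false] at h
  simp only [prob, ← Complex.re_sum]
  refine (congrArg Complex.re h).trans ?_
  have := expect_one ρ
  rw [hρ.trace_eq_one] at this
  exact (congrArg Complex.re this).trans Complex.one_re

theorem trace_marg_outcomeOp {C : Finset V} {z : V → Option (Fin d × Fin d × Fin 4)}
    (hz : z ∈ outcomes d C) {i : V} (hi : i ∉ C) :
    (marg ρ (outcomeOp z) i).trace = expect ρ (outcomeOp z) := by
  rw [trace_marg, ← outcomeOp_eq_one hz hi, Function.update_eq_self]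

/-- The mean purity of site `i` after a measurement of the other sites of `C`. Leaving `i` itself
out makes this monotone in `C`. -/
def meanPurity (ρ : Matrix (V → Fin d) (V → Fin d) ℂ) (i : V) (C : Finset V) : ℝ :=
  ∑ z ∈ outcomes d (C.erase i), purity (marg ρ (outcomeOp z) i)

theorem meanPurity_nonneg (hρ : ρ.PosSemidef) (i : V) (C : Finset V) : 0 ≤ meanPurity ρ i C :=
  Finset.sum_nonneg fun z _ => purity_nonneg (marg_posSemidef hρ (outcomeOp_posSemidef z) i)

theorem meanPurity_le_one [NeZero d] (hρ : IsState ρ) (i : V) (C : Finset V) :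
    meanPurity ρ i C ≤ 1 := by
  rw [← sum_prob hρ (C.erase i)]
  refine Finset.sum_le_sum fun z hz => ?_
  refine (purity_le_trace (marg_posSemidef hρ.posSemidef (outcomeOp_posSemidef z) i)).trans ?_
  rw [trace_marg_outcomeOp hz (Finset.notMem_erase i C), prob]

theorem pairMap_posSemidef (hρ : ρ.PosSemidef) {A : V → Matrix (Fin d) (Fin d) ℂ}
    (hA : ∀ k, (A k).PosSemidef) {i j : V} (hij : i ≠ j) (B : Matrix (Fin d) (Fin d) ℂ)
    (hB : B.PosSemidef) : (pairMap ρ A i j B).PosSemidef := by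
  rw [pairMap_eq_marg ρ A hij]
  refine marg_posSemidef hρ (fun k => ?_) i
  rcases eq_or_ne k j with rfl | h
  · simpa using hB
  · simpa [h] using hA k

theorem pairMap_one {C : Finset V} {z : V → Option (Fin d × Fin d × Fin 4)}
    (hz : z ∈ outcomes d C) {i j : V} (hij : i ≠ j) (hj : j ∉ C) :
    pairMap ρ (outcomeOp z) i j 1 = marg ρ (outcomeOp z) i := by
  rw [pairMap_eq_marg ρ _ hij, ← outcomeOp_eq_one hz hj, Function.update_eq_self]

theorem sum_purityGain {C : Finset V} {i j : V} (hij : i ≠ j) (hi : i ∉ C) (hj : j ∉ C) :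
    ∑ z ∈ outcomes d C, purityGain (pairMap ρ (outcomeOp z) i j)
      = meanPurity ρ i (insert j C) - meanPurity ρ i C := by
  have h1 : (insert j C).erase i = insert j C := Finset.erase_eq_of_notMem (by simp [hij, hi])
  rw [meanPurity, meanPurity, h1, Finset.erase_eq_of_notMem hi, sum_outcomes_insert hj,
    ← Finset.sum_sub_distrib]
  refine Finset.sum_congr rfl fun z hz => ?_
  rw [purityGain, pairMap_one hz hij hj]
  simp only [pairMap_eq_marg ρ _ hij, outcomeOp_update]

theorem meanPurity_le_insert [NeZero d] (hρ : ρ.PosSemidef) (i j : V) (C : Finset V) :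
    meanPurity ρ i C ≤ meanPurity ρ i (insert j C) := by
  have key : ∀ D : Finset V, i ∉ D → meanPurity ρ i D ≤ meanPurity ρ i (insert j D) := by
    intro D hD
    rcases eq_or_ne i j with rfl | hij
    · rw [meanPurity, meanPurity, Finset.erase_insert_eq_erase]
    · by_cases hj : j ∈ D
      · rw [Finset.insert_eq_of_mem hj]
      · rw [← sub_nonneg, ← sum_purityGain hij hD hj]
        exact Finset.sum_nonneg fun z _ => purityGain_nonneg
          (pairMap_posSemidef hρ (outcomeOp_posSemidef z) hij)
  have e1 : meanPurity ρ i C = meanPurity ρ i (C.erase i) := by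
    rw [meanPurity, meanPurity, Finset.erase_idem]
  have e2 : meanPurity ρ i (insert j C) = meanPurity ρ i (insert j (C.erase i)) := by
    have : (insert j C).erase i = (insert j (C.erase i)).erase i := by ext; simp; tauto
    rw [meanPurity, meanPurity, this]
  rw [e1, e2]
  exact key _ (Finset.notMem_erase i C)

end Conditioning

/-! ### The separable approximation -/

section SeparableApproximation

variable {V : Type*} [Fintype V] [DecidableEq V] {d : ℕ}

/-- The state proportional to a positive semidefinite matrix; the maximally mixed state if that
matrix has trace zero. -/
def normalize (A : Matrix (Fin d) (Fin d) ℂ) : Matrix (Fin d) (Fin d) ℂ :=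
  if A.trace = 0 then (d : ℂ)⁻¹ • 1 else A.trace⁻¹ • A

theorem normalize_isState [NeZero d] {A : Matrix (Fin d) (Fin d) ℂ} (hA : A.PosSemidef) :
    IsState (normalize A) := by
  have hd : (d : ℂ) ≠ 0 := Nat.cast_ne_zero.mpr (NeZero.ne d)
  unfold normalize
  split_ifs with h
  · refine ⟨PosSemidef.one.smul ?_, by simp [hd]⟩
    rw [← Complex.ofReal_natCast, ← Complex.ofReal_inv, Complex.zero_le_real]
    positivity
  · refine ⟨hA.smul ?_, by simp [h]⟩
    rw [← ofReal_re_trace hA, ← Complex.ofReal_inv, Complex.zero_le_real]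
    exact inv_nonneg.mpr (re_trace_nonneg hA)

theorem tensor_isState {τ : V → Matrix (Fin d) (Fin d) ℂ} (hτ : ∀ i, IsState (τ i)) :
    IsState (tensor τ) :=
  ⟨tensor_posSemidef fun i => (hτ i).posSemidef, by simp [trace_tensor, (hτ _).trace_eq_one]⟩

theorem reduce_eq_sum_submatrix (S : Finset V) (ρ : Matrix (V → Fin d) (V → Fin d) ℂ) :
    reduce S ρ = ∑ z, ρ.submatrix (fun a => glue S a z) (fun a => glue S a z) := by
  ext a b
  simp [reduce, Matrix.sum_apply]

theorem reduce_isState {ρ : Matrix (V → Fin d) (V → Fin d) ℂ} (hρ : IsState ρ) (S : Finset V) :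
    IsState (reduce S ρ) := by
  refine ⟨?_, ?_⟩
  · rw [reduce_eq_sum_submatrix]
    exact posSemidef_sum _ fun z _ => hρ.posSemidef.submatrix _
  · rw [← hρ.trace_eq_one]
    simp only [trace, diag_apply, reduce]
    rw [← Fintype.sum_prod_type']
    exact Equiv.sum_comp (Equiv.piEquivPiSubtypeProd (fun i => i ∈ S) (fun _ => Fin d)).symm
      (fun x => ρ x x)

/-- The separable state obtained by measuring the sites of `C` and preparing, for each string of
outcomes, the product of the conditional states of the single sites. -/
def sepApprox (ρ : Matrix (V → Fin d) (V → Fin d) ℂ) (C : Finset V) :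
    Matrix (V → Fin d) (V → Fin d) ℂ :=
  ∑ z ∈ outcomes d C, prob ρ z • tensor fun k => normalize (marg ρ (outcomeOp z) k)

variable {ρ : Matrix (V → Fin d) (V → Fin d) ℂ}

theorem normalize_marg_isState [NeZero d] (hρ : ρ.PosSemidef)
    (z : V → Option (Fin d × Fin d × Fin 4)) (k : V) :
    IsState (normalize (marg ρ (outcomeOp z) k)) :=
  normalize_isState (marg_posSemidef hρ (outcomeOp_posSemidef z) k)

theorem sepApprox_isSeparable [NeZero d] (hρ : IsState ρ) (C : Finset V) :
    IsSeparable (sepApprox ρ C) :=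
  (convex_convexHull ℝ _).sum_mem (fun z _ => prob_nonneg hρ.posSemidef z) (sum_prob hρ C)
    fun z _ => subset_convexHull ℝ _ ⟨_, normalize_marg_isState hρ.posSemidef z, rfl⟩

theorem sepApprox_isState [NeZero d] (hρ : IsState ρ) (C : Finset V) :
    IsState (sepApprox ρ C) := by
  have h := fun z => tensor_isState (normalize_marg_isState hρ.posSemidef z)
  refine ⟨posSemidef_sum _ fun z _ => (h z).posSemidef.smul (prob_nonneg hρ.posSemidef z), ?_⟩
  simp only [sepApprox, trace_sum, trace_smul, (h _).trace_eq_one]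
  rw [← Finset.sum_smul, sum_prob hρ C, one_smul]

theorem reduce_pair_apply (A : Matrix (V → Fin d) (V → Fin d) ℂ) {i j : V} (hij : i ≠ j)
    {C : Finset V} [NeZero d] (hi : i ∉ C) (hj : j ∉ C)
    (a b : {k // k ∈ ({i, j} : Finset V)} → Fin d) :
    reduce {i, j} A a b = ∑ z ∈ outcomes d C, pairMap A (outcomeOp z) i j
      (single (b ⟨j, by simp⟩) (a ⟨j, by simp⟩) 1) (a ⟨i, by simp⟩) (b ⟨i, by simp⟩) := by
  have h := sum_expect_outcomes A (C := C) (D := {i, j}) (by simp [hi, hj]) (entryOp {i, j} a b)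
  have e : (fun k => if k ∈ ({i, j} : Finset V) then entryOp {i, j} a b k else 1)
      = entryOp {i, j} a b := by
    ext1 k
    by_cases hk : k ∈ ({i, j} : Finset V)
    · rw [if_pos hk]
    · rw [if_neg hk, entryOp, dif_neg hk]
  rw [e] at h
  rw [reduce_apply_eq_expect, ← h]
  refine Finset.sum_congr rfl fun z _ => ?_
  simp only [pairMap, LinearMap.coe_mk, AddHom.coe_mk, of_apply]
  congr 1
  ext1 k
  rcases eq_or_ne k j with rfl | hkj
  · simp [entryOp]
  · rcases eq_or_ne k i with rfl | hki
    · simp [entryOp, hkj]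
    · simp [hkj, hki]

theorem reduce_pair_tensor {τ : V → Matrix (Fin d) (Fin d) ℂ} (hτ : ∀ k, IsState (τ k))
    {i j : V} (hij : i ≠ j) (a b : {k // k ∈ ({i, j} : Finset V)} → Fin d) :
    reduce {i, j} (tensor τ) a b = τ i (a ⟨i, by simp⟩) (b ⟨i, by simp⟩)
      * τ j (a ⟨j, by simp⟩) (b ⟨j, by simp⟩) := by
  rw [reduce_apply_eq_expect, expect_tensor,
    ← Finset.prod_subset (Finset.subset_univ ({i, j} : Finset V)), Finset.prod_pair hij]
  · congr 1 <;> simp [entryOp, trace_mul_single]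
  · intro k _ hk
    simp only [entryOp, dif_neg hk, mul_one, (hτ k).trace_eq_one]

/-- On a pair of unmeasured sites, the error of the separable approximation is the average over
the outcomes of the conditional correlation between the two sites. -/
theorem reduce_sub_reduce_sepApprox [NeZero d] (hρ : IsState ρ) {i j : V} (hij : i ≠ j)
    {C : Finset V} (hi : i ∉ C) (hj : j ∉ C) (a b : {k // k ∈ ({i, j} : Finset V)} → Fin d) :
    (reduce {i, j} ρ - reduce {i, j} (sepApprox ρ C)) a b
      = ∑ z ∈ outcomes d C, correl (pairMap ρ (outcomeOp z) i j)
        (single (b ⟨j, by simp⟩) (a ⟨j, by simp⟩) 1) (a ⟨i, by simp⟩) (b ⟨i, by simp⟩) := by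
  have e : reduce {i, j} (sepApprox ρ C) a b = ∑ z ∈ outcomes d C, (prob ρ z : ℂ) *
      reduce {i, j} (tensor fun k => normalize (marg ρ (outcomeOp z) k)) a b := by
    simp only [reduce, sepApprox, Matrix.sum_apply, Matrix.smul_apply, Complex.real_smul,
      Finset.mul_sum]
    rw [Finset.sum_comm]
  rw [Matrix.sub_apply, reduce_pair_apply ρ hij hi hj, e, ← Finset.sum_sub_distrib]
  refine Finset.sum_congr rfl fun z hz => ?_
  have hji : j ≠ i := hij.symm
  have t1 : (pairMap ρ (outcomeOp z) i j (single (b ⟨j, by simp⟩) (a ⟨j, by simp⟩) 1)).trace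
      = marg ρ (outcomeOp z) j (a ⟨j, by simp⟩) (b ⟨j, by simp⟩) := by
    rw [pairMap_eq_marg ρ _ hij, trace_marg, Function.update_comm hji,
      ← outcomeOp_eq_one hz hi, Function.update_eq_self]
    rfl
  rw [reduce_pair_tensor (normalize_marg_isState hρ.posSemidef z) hij, correl_apply,
    Matrix.sub_apply, Matrix.smul_apply, t1, pairMap_one hz hij hj, trace_marg_outcomeOp hz hi,
    ofReal_prob hρ.posSemidef, normalize, normalize, trace_marg_outcomeOp hz hi,
    trace_marg_outcomeOp hz hj]
  congr 1
  by_cases h : expect ρ (outcomeOp z) = 0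
  · simp [h]
  · simp only [if_neg h, Matrix.smul_apply, smul_eq_mul]
    field_simp

/-- Configurations on two distinct sites are pairs. -/
def pairEquiv (d : ℕ) {i j : V} (hij : i ≠ j) :
    ({k // k ∈ ({i, j} : Finset V)} → Fin d) ≃ Fin d × Fin d where
  toFun a := (a ⟨i, by simp⟩, a ⟨j, by simp⟩)
  invFun p k := if k.1 = i then p.1 else p.2
  left_inv a := by
    ext1 ⟨k, hk⟩
    rcases Finset.mem_insert.mp hk with rfl | h
    · simp
    · obtain rfl := Finset.mem_singleton.mp h
      simp [hij.symm]
  right_inv p := by simp [hij.symm]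

theorem traceNorm_reduce_sub_le_of_notMem [NeZero d] (hρ : IsState ρ) {i j : V} (hij : i ≠ j)
    {C : Finset V} (hi : i ∉ C) (hj : j ∉ C) {t : ℝ} (ht : 0 < t) :
    traceNorm (reduce {i, j} ρ - reduce {i, j} (sepApprox ρ C))
      ≤ d * (t + 2 * (meanPurity ρ i (insert j C) - meanPurity ρ i C) / t) := by
  obtain ⟨Ω, hΩ, h⟩ := exists_partialIsometry_trace_mul_eq_traceNorm
    (reduce {i, j} ρ - reduce {i, j} (sepApprox ρ C))
  set E := pairEquiv d hij with hE
  set ω : Fin d → Fin d → Matrix (Fin d) (Fin d) ℂ := fun k l =>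
    of fun a b => Ω (E.symm (b, l)) (E.symm (a, k)) with hω
  have hcol : ∀ k, ∑ l, frobSq (ω k l) ≤ d := fun k => by
    calc ∑ l, frobSq (ω k l) = ∑ a, ∑ b, ∑ l, ‖Ω (E.symm (b, l)) (E.symm (a, k))‖ ^ 2 := by
          simp only [frobSq, hω, of_apply]
          rw [Finset.sum_comm]
          exact Finset.sum_congr rfl fun a _ => Finset.sum_comm
      _ = ∑ a, ∑ f, ‖Ω f (E.symm (a, k))‖ ^ 2 := by
          refine Finset.sum_congr rfl fun a _ => ?_
          rw [← Fintype.sum_prod_type']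
          exact Equiv.sum_comp E.symm fun f => ‖Ω f (E.symm (a, k))‖ ^ 2
      _ ≤ ∑ _a : Fin d, 1 := Finset.sum_le_sum fun a _ => sum_norm_sq_col_le_one hΩ _
      _ = d := by simp
  have hrow : ∀ l, ∑ k, frobSq (ω k l) ≤ d := fun l => by
    calc ∑ k, frobSq (ω k l) = ∑ b, ∑ a, ∑ k, ‖Ω (E.symm (b, l)) (E.symm (a, k))‖ ^ 2 := by
          simp only [frobSq, hω, of_apply]
          rw [Finset.sum_comm]
          exact (Finset.sum_congr rfl fun a _ => Finset.sum_comm).trans Finset.sum_comm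
      _ = ∑ b, ∑ f, ‖Ω (E.symm (b, l)) f‖ ^ 2 := by
          refine Finset.sum_congr rfl fun b _ => ?_
          rw [← Fintype.sum_prod_type']
          exact Equiv.sum_comp E.symm fun f => ‖Ω (E.symm (b, l)) f‖ ^ 2
      _ ≤ ∑ _b : Fin d, 1 := Finset.sum_le_sum fun b _ => sum_norm_sq_row_le_one hΩ _
      _ = d := by simp
  have htr : (traceNorm (reduce {i, j} ρ - reduce {i, j} (sepApprox ρ C)) : ℂ)
      = ∑ z ∈ outcomes d C, ∑ k, ∑ l, ∑ a, ∑ b,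
        correl (pairMap ρ (outcomeOp z) i j) (single l k 1) a b * ω k l a b := by
    rw [← h]
    simp only [trace, diag_apply, mul_apply, reduce_sub_reduce_sepApprox hρ hij hi hj,
      Finset.sum_mul]
    have e : ∀ f : ({k // k ∈ ({i, j} : Finset V)} → Fin d) → ℂ,
        ∑ x, f x = ∑ k, ∑ a, f (E.symm (a, k)) := fun f => by
      rw [← Equiv.sum_comp E.symm, Fintype.sum_prod_type, Finset.sum_comm]
    have hEi : ∀ a k, (E.symm (a, k)) ⟨i, by simp⟩ = a := fun a k => by simp [hE, pairEquiv]
    have hEj : ∀ a k, (E.symm (a, k)) ⟨j, by simp⟩ = k := fun a k => by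
      simp [hE, pairEquiv, hij.symm]
    simp only [e, hEi, hEj, hω, of_apply]
    refine Eq.trans (Finset.sum_congr rfl fun k _ => ?_) Finset.sum_comm
    refine Finset.sum_comm.trans (Eq.trans (Finset.sum_congr rfl fun l _ => ?_) Finset.sum_comm)
    exact Eq.trans (Finset.sum_congr rfl fun a _ => Finset.sum_comm) Finset.sum_comm
  have hbound : ∀ z ∈ outcomes d C, ‖∑ k, ∑ l, ∑ a, ∑ b,
      correl (pairMap ρ (outcomeOp z) i j) (single l k 1) a b * ω k l a b‖
      ≤ d * (t * prob ρ z + 2 * purityGain (pairMap ρ (outcomeOp z) i j) / t) := fun z hz => by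
    have := norm_sum_correl_mul_le (pairMap_posSemidef hρ.posSemidef (outcomeOp_posSemidef z) hij)
      ω hcol hrow ht
    rwa [pairMap_one hz hij hj, trace_marg_outcomeOp hz hi] at this
  have h1 : traceNorm (reduce {i, j} ρ - reduce {i, j} (sepApprox ρ C))
      ≤ ∑ z ∈ outcomes d C,
        d * (t * prob ρ z + 2 * purityGain (pairMap ρ (outcomeOp z) i j) / t) := by
    refine (le_abs_self _).trans ?_
    rw [← Real.norm_eq_abs, ← Complex.norm_real, htr]
    exact (norm_sum_le _ _).trans (Finset.sum_le_sum hbound)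
  refine h1.trans (le_of_eq ?_)
  rw [← Finset.mul_sum, Finset.sum_add_distrib, ← Finset.mul_sum, sum_prob hρ, mul_one,
    ← Finset.sum_div, ← Finset.mul_sum, sum_purityGain hij hi hj]

/-- The error of the separable approximation on a pair of sites; pairs that meet the measured
set `C` are estimated trivially. -/
theorem traceNorm_reduce_sub_le [NeZero d] (hρ : IsState ρ) {i j : V} (hij : i ≠ j)
    (C : Finset V) {t : ℝ} (ht : 0 < t) :
    traceNorm (reduce s(i, j).toFinset ρ - reduce s(i, j).toFinset (sepApprox ρ C))
      ≤ d * (t + 2 * (meanPurity ρ i (insert j C) - meanPurity ρ i C) / t)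
        + ((if i ∈ C then 2 else 0) + if j ∈ C then 2 else 0) := by
  have h0 : 0 ≤ d * (t + 2 * (meanPurity ρ i (insert j C) - meanPurity ρ i C) / t) := by
    have := sub_nonneg.mpr (meanPurity_le_insert hρ.posSemidef i j C)
    positivity
  have h2 := traceNorm_sub_le_two (reduce_isState hρ s(i, j).toFinset)
    (reduce_isState (sepApprox_isState hρ C) s(i, j).toFinset)
  by_cases hi : i ∈ C
  · rw [if_pos hi]
    have : (0 : ℝ) ≤ if j ∈ C then 2 else 0 := by split_ifs <;> norm_num
    linarith
  · by_cases hj : j ∈ C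
    · rw [if_neg hi, if_pos hj]
      linarith
    · rw [if_neg hi, if_neg hj, add_zero, add_zero, Sym2.toFinset_mk_eq]
      exact traceNorm_reduce_sub_le_of_notMem hρ hij hi hj ht

end SeparableApproximation

/-! ### Averaging over the edges -/

section Graphs

variable {V : Type*} [Fintype V] [DecidableEq V]

/-- Every edge is counted from both of its ends. -/
theorem sum_adj_eq_two_mul_sum_edgeFinset (G : SimpleGraph V) [DecidableRel G.Adj]
    (f : Sym2 V → ℝ) :
    ∑ i, ∑ j, (if G.Adj i j then f s(i, j) else 0) = 2 * ∑ e ∈ G.edgeFinset, f e := by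
  have h1 : ∑ D : G.Dart, f D.edge = 2 * ∑ e ∈ G.edgeFinset, f e := by
    rw [← Finset.sum_fiberwise_of_maps_to (s := Finset.univ) (t := G.edgeFinset)
      (g := fun D : G.Dart => D.edge) (fun D _ => by simp [D.edge_mem]), Finset.mul_sum]
    refine Finset.sum_congr rfl fun e he => ?_
    rw [Finset.sum_congr rfl fun D hD => congrArg f (Finset.mem_filter.mp hD).2,
      Finset.sum_const, G.dart_edge_fiber_card e (SimpleGraph.mem_edgeFinset.mp he)]
    simp
  rw [← h1, ← Fintype.sum_prod_type', ← Finset.sum_filter]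
  symm
  refine Finset.sum_bij (fun D _ => D.toProd) (fun D _ => by simp [D.adj])
    (fun D _ D' _ h => SimpleGraph.Dart.toProd_injective h)
    (fun p hp => ⟨⟨p, (Finset.mem_filter.mp hp).2⟩, Finset.mem_univ _, rfl⟩) fun D _ => rfl

theorem sum_edgeFinset_starGraph (r : V) (f : Sym2 V → ℝ) :
    ∑ e ∈ (SimpleGraph.starGraph r).edgeFinset, f e = ∑ j ∈ Finset.univ.erase r, f s(r, j) := by
  symm
  refine Finset.sum_bij (fun j _ => s(r, j)) ?_ ?_ ?_ fun _ _ => rfl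
  · intro j hj
    simpa [eq_comm] using hj
  · intro j hj j' hj' h
    simp only [Sym2.eq_iff] at h
    grind
  · intro e he
    induction e with | _ x y
    simp only [SimpleGraph.mem_edgeFinset, SimpleGraph.mem_edgeSet, SimpleGraph.starGraph_adj] at he
    obtain ⟨hxy, rfl | rfl⟩ := he
    · exact ⟨y, by simp [hxy.symm], rfl⟩
    · exact ⟨x, by simp [hxy], Sym2.eq_swap⟩

variable {d : ℕ} {ρ : Matrix (V → Fin d) (V → Fin d) ℂ}

/-- The set `C` to be measured maximises the total mean purity with a price `B` on each site. Then
`B * |C|` is at most the number of sites, and measuring one more site gains at most `B`, which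
bounds the correlations on the edges that avoid `C`. -/
theorem edgeDist_sepApprox_le_of_isRegular [Nonempty V] [NeZero d] (G : SimpleGraph V)
    [DecidableRel G.Adj] {c : ℕ} (hc : 1 ≤ c) (hG : G.IsRegularOfDegree c) (hρ : IsState ρ)
    {B t : ℝ} (hB : 0 < B) (ht : 0 < t) :
    ∃ C : Finset V, edgeDist G ρ (sepApprox ρ C) ≤ d * (t + 2 * B / (c * t)) + 4 / B := by
  obtain ⟨C, hC⟩ := Finite.exists_max fun C : Finset V => ∑ i, meanPurity ρ i C - B * C.card
  refine ⟨C, ?_⟩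
  set N : ℝ := (Fintype.card V : ℝ) with hN
  have hN0 : 0 < N := Nat.cast_pos.mpr Fintype.card_pos
  have hc0 : (0 : ℝ) < c := Nat.cast_pos.mpr hc
  set δ : V → V → ℝ := fun i j => meanPurity ρ i (insert j C) - meanPurity ρ i C with hδ
  have hδ0 : ∀ i j, 0 ≤ δ i j := fun i j =>
    sub_nonneg.mpr (meanPurity_le_insert hρ.posSemidef i j C)
  have hcard : B * C.card ≤ N := by
    have h1 := hC ∅
    have h2 : (0 : ℝ) ≤ ∑ i, meanPurity ρ i ∅ :=
      Finset.sum_nonneg fun i _ => meanPurity_nonneg hρ.posSemidef i ∅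
    have h3 : ∑ i, meanPurity ρ i C ≤ N :=
      (Finset.sum_le_sum fun i _ => meanPurity_le_one hρ i C).trans (by simp [hN])
    simp only [Finset.card_empty, Nat.cast_zero, mul_zero, sub_zero] at h1
    linarith
  have hgain : ∀ j, ∑ i, δ i j ≤ B := fun j => by
    have h1 := hC (insert j C)
    have h2 : ((insert j C).card : ℝ) ≤ C.card + 1 := by exact_mod_cast Finset.card_insert_le j C
    rw [hδ, Finset.sum_sub_distrib]
    nlinarith
  have hdeg : ∀ i, ∑ j, (if G.Adj i j then (1 : ℝ) else 0) = c := fun i => by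
    rw [Finset.sum_boole, ← hG i, ← SimpleGraph.card_neighborFinset_eq_degree,
      SimpleGraph.neighborFinset_eq_filter]
  have hE : 2 * (G.edgeFinset.card : ℝ) = N * c := by
    have h := sum_adj_eq_two_mul_sum_edgeFinset G fun _ => 1
    simp only [hdeg, Finset.sum_const, nsmul_eq_mul, mul_one, Finset.card_univ] at h
    exact h.symm
  have htouch : ∑ i, ∑ j, (if G.Adj i j then (if i ∈ C then (2 : ℝ) else 0) else 0)
      = 2 * C.card * c := by
    have e : ∀ i j, (if G.Adj i j then (if i ∈ C then (2 : ℝ) else 0) else 0)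
        = (if i ∈ C then 2 else 0) * if G.Adj i j then 1 else 0 := fun i j => by
      split_ifs <;> simp
    simp only [e, ← Finset.mul_sum, hdeg, ← Finset.sum_mul]
    rw [Finset.sum_ite_mem, Finset.univ_inter, Finset.sum_const, nsmul_eq_mul, mul_comm (2 : ℝ)]
  have htouch' : ∑ i, ∑ j, (if G.Adj i j then (if j ∈ C then (2 : ℝ) else 0) else 0)
      = 2 * C.card * c := by
    rw [Finset.sum_comm, ← htouch]
    simp only [G.adj_comm]
  set f : Sym2 V → ℝ := fun e =>
    traceNorm (reduce e.toFinset ρ - reduce e.toFinset (sepApprox ρ C)) with hf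
  have hsum : 2 * ∑ e ∈ G.edgeFinset, f e
      ≤ d * (t * (N * c) + 2 * (N * B) / t) + (2 * C.card * c + 2 * C.card * c) := by
    rw [← sum_adj_eq_two_mul_sum_edgeFinset]
    calc _ ≤ ∑ i, ∑ j, ((d * (t * (if G.Adj i j then 1 else 0) + 2 * δ i j / t)) +
          ((if G.Adj i j then (if i ∈ C then (2 : ℝ) else 0) else 0)
            + (if G.Adj i j then (if j ∈ C then (2 : ℝ) else 0) else 0))) := by
          refine Finset.sum_le_sum fun i _ => Finset.sum_le_sum fun j _ => ?_
          by_cases h : G.Adj i j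
          · simpa only [if_pos h, mul_one] using traceNorm_reduce_sub_le hρ h.ne C ht
          · simp only [if_neg h, mul_zero, zero_add, add_zero]
            have := hδ0 i j
            positivity
      _ = d * (t * (N * c) + 2 * (∑ j, ∑ i, δ i j) / t) + (2 * C.card * c + 2 * C.card * c) := by
          rw [Finset.sum_comm (f := fun j i => δ i j)]
          simp only [Finset.sum_add_distrib, ← Finset.mul_sum, htouch, htouch', hdeg,
            ← Finset.sum_div, Finset.sum_const, Finset.card_univ, nsmul_eq_mul, hN]
      _ ≤ _ := by
          have : ∑ j, ∑ i, δ i j ≤ N * B :=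
            (Finset.sum_le_sum fun j _ => hgain j).trans (by simp [hN])
          gcongr
  have hE' : (G.edgeFinset.card : ℝ) = N * c / 2 := by linarith
  have hEdef : edgeDist G ρ (sepApprox ρ C) = (2 * ∑ e ∈ G.edgeFinset, f e) / (N * c) := by
    rw [edgeDist, hE']
    change (∑ e ∈ G.edgeFinset, f e) / _ = _
    field_simp
  rw [hEdef, div_le_iff₀ (by positivity)]
  refine hsum.trans ?_
  have h4 : (C.card : ℝ) ≤ N / B := by rw [le_div_iff₀ hB, mul_comm]; exact hcard
  calc _ ≤ d * (t * (N * c) + 2 * (N * B) / t) + (2 * (N / B) * c + 2 * (N / B) * c) := by gcongr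
    _ = _ := by field_simp; ring

/-- For a star it suffices to measure leaves, and only the purity of the root matters. -/
theorem edgeDist_starGraph_sepApprox_le [NeZero d] (r : V) (hV : 2 ≤ Fintype.card V)
    (hρ : IsState ρ) {B t : ℝ} (hB : 0 < B) (ht : 0 < t) :
    ∃ C : Finset V, edgeDist (SimpleGraph.starGraph r) ρ (sepApprox ρ C)
      ≤ d * (t + 2 * B / t) + 2 / (B * ((Fintype.card V : ℝ) - 1)) := by
  obtain ⟨C, hCmem, hC⟩ := Finset.exists_max_image (Finset.univ.erase r).powerset
    (fun C : Finset V => meanPurity ρ r C - B * C.card) ⟨∅, by simp⟩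
  refine ⟨C, ?_⟩
  have hCr : C ⊆ Finset.univ.erase r := Finset.mem_powerset.mp hCmem
  have hrC : r ∉ C := fun h => by simpa using hCr h
  set n : ℝ := (Fintype.card V : ℝ) - 1 with hn
  have hn0 : 0 < n := by
    have : (2 : ℝ) ≤ Fintype.card V := by exact_mod_cast hV
    linarith
  have hcardE : ((Finset.univ.erase r).card : ℝ) = n := by
    rw [Finset.card_erase_of_mem (Finset.mem_univ r), Finset.card_univ, Nat.cast_sub (by omega), hn]
    simp
  have hcard : B * C.card ≤ 1 := by
    have h1 := hC ∅ (by simp)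
    have h2 := meanPurity_nonneg hρ.posSemidef r ∅
    have h3 := meanPurity_le_one hρ r C
    simp only [Finset.card_empty, Nat.cast_zero, mul_zero, sub_zero] at h1
    linarith
  have hgain : ∀ j ∈ Finset.univ.erase r,
      meanPurity ρ r (insert j C) - meanPurity ρ r C ≤ B := fun j hj => by
    have h1 := hC (insert j C) (Finset.mem_powerset.mpr (Finset.insert_subset hj hCr))
    have h2 : ((insert j C).card : ℝ) ≤ C.card + 1 := by exact_mod_cast Finset.card_insert_le j C
    nlinarith
  have hE : ((SimpleGraph.starGraph r).edgeFinset.card : ℝ) = n := by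
    have := sum_edgeFinset_starGraph r fun _ => 1
    simp only [Finset.sum_const, nsmul_eq_mul, mul_one] at this
    rw [this, hcardE]
  rw [edgeDist, hE, div_le_iff₀ hn0, sum_edgeFinset_starGraph]
  calc _ ≤ ∑ j ∈ Finset.univ.erase r, (d * (t + 2 * B / t) + if j ∈ C then 2 else 0) := by
        refine Finset.sum_le_sum fun j hj => ?_
        have h1 := traceNorm_reduce_sub_le hρ (Finset.ne_of_mem_erase hj).symm C ht
        rw [if_neg hrC, zero_add] at h1
        refine h1.trans ?_
        have := hgain j hj
        gcongr
    _ = n * (d * (t + 2 * B / t)) + 2 * C.card := by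
        rw [Finset.sum_add_distrib, Finset.sum_const, nsmul_eq_mul, hcardE, Finset.sum_ite_mem,
          Finset.inter_eq_right.mpr hCr, Finset.sum_const, nsmul_eq_mul, mul_comm (C.card : ℝ)]
    _ ≤ n * (d * (t + 2 * B / t)) + 2 * (1 / B) := by
        have : (C.card : ℝ) ≤ 1 / B := by rw [le_div_iff₀ hB, mul_comm]; exact hcard
        gcongr
    _ = _ := by field_simp

end Graphs

/-! ### The choice of the parameters -/

/-- The scale `q = (d² / x) ^ (1 / 3)` of both error estimates. It carries no logarithm; the factor
`4 / 5` comes from `log d ≥ log 2 > (4 / 5) ^ 3`. -/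
theorem exists_cube_root_scale {d : ℕ} (hd : 2 ≤ d) {x : ℝ} (hx : 0 < x) :
    ∃ q : ℝ, 0 < q ∧ q ^ 3 = (d : ℝ) ^ 2 / x ∧
      4 / 5 * q ≤ ((d : ℝ) ^ 2 * Real.log d / x) ^ (1 / 3 : ℝ) := by
  have hd0 : (0 : ℝ) < d := by positivity
  have hy : 0 < (d : ℝ) ^ 2 / x := by positivity
  have h3 : (((d : ℝ) ^ 2 / x) ^ (1 / 3 : ℝ)) ^ 3 = (d : ℝ) ^ 2 / x := by
    rw [← Real.rpow_natCast, ← Real.rpow_mul hy.le]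
    norm_num
  refine ⟨((d : ℝ) ^ 2 / x) ^ (1 / 3 : ℝ), by positivity, h3, ?_⟩
  have hlog : (64 / 125 : ℝ) ≤ Real.log d := by
    have h1 : Real.log 2 ≤ Real.log d := Real.log_le_log (by norm_num) (by exact_mod_cast hd)
    have := Real.log_two_gt_d9
    linarith
  have h45 : ((64 / 125 : ℝ)) ^ (1 / 3 : ℝ) = 4 / 5 := by
    rw [show (64 / 125 : ℝ) = (4 / 5) ^ (3 : ℝ) by norm_num, ← Real.rpow_mul (by norm_num)]
    norm_num
  calc 4 / 5 * ((d : ℝ) ^ 2 / x) ^ (1 / 3 : ℝ) = (64 / 125 * ((d : ℝ) ^ 2 / x)) ^ (1 / 3 : ℝ) := by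
        rw [Real.mul_rpow (by norm_num) hy.le, h45]
    _ ≤ _ := by
        refine Real.rpow_le_rpow (by positivity) ?_ (by norm_num)
        rw [mul_div_right_comm, mul_comm]
        gcongr

section LocalDimensionOne

variable {V : Type*} [Fintype V] [DecidableEq V]

/-- With one-dimensional sites there is only one state, and it is a product state. -/
theorem exists_isSeparable_edgeDist_eq_zero (G : SimpleGraph V) [DecidableRel G.Adj]
    {ρ : Matrix (V → Fin 1) (V → Fin 1) ℂ} (hρ : IsState ρ) :
    ∃ σ : Matrix (V → Fin 1) (V → Fin 1) ℂ, IsSeparable σ ∧ edgeDist G ρ σ = 0 := by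
  have h1 : IsState (1 : Matrix (Fin 1) (Fin 1) ℂ) := ⟨PosSemidef.one, by simp⟩
  have hσ := tensor_isState (V := V) (τ := fun _ => (1 : Matrix (Fin 1) (Fin 1) ℂ)) fun _ => h1
  have : ρ = tensor fun _ : V => (1 : Matrix (Fin 1) (Fin 1) ℂ) := by
    have h := hρ.trace_eq_one.trans hσ.trace_eq_one.symm
    ext x y
    rw [Subsingleton.elim x default, Subsingleton.elim y default]
    simpa [trace] using h
  exact ⟨_, subset_convexHull ℝ _ ⟨_, fun _ => h1, rfl⟩, by simp [edgeDist, ← this, traceNorm_zero]⟩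

end LocalDimensionOne

theorem not_isState_of_dim_zero {V : Type*} [Fintype V] [DecidableEq V] [Nonempty V]
    (ρ : Matrix (V → Fin 0) (V → Fin 0) ℂ) : ¬ IsState ρ := fun h => by
  simpa [trace] using h.trace_eq_one

section Main

variable {V : Type*} [Fintype V] [DecidableEq V] [Nonempty V] {d : ℕ}
  {ρ : Matrix (V → Fin d) (V → Fin d) ℂ}

theorem exists_isSeparable_edgeDist_le_of_isRegular (G : SimpleGraph V) [DecidableRel G.Adj]
    {c : ℕ} (hc : 1 ≤ c) (hG : G.IsRegularOfDegree c) (hρ : IsState ρ) :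
    ∃ σ : Matrix (V → Fin d) (V → Fin d) ℂ, IsSeparable σ ∧
      edgeDist G ρ σ ≤ 12 * ((d : ℝ) ^ 2 * Real.log d / (c : ℝ)) ^ (1 / 3 : ℝ) := by
  obtain rfl | rfl | hd : d = 0 ∨ d = 1 ∨ 2 ≤ d := by omega
  · exact (not_isState_of_dim_zero ρ hρ).elim
  · obtain ⟨σ, hσ, h⟩ := exists_isSeparable_edgeDist_eq_zero G hρ
    exact ⟨σ, hσ, by simp [h]⟩
  · have : NeZero d := ⟨by omega⟩
    have hd0 : (0 : ℝ) < d := by positivity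
    have hc0 : (0 : ℝ) < c := Nat.cast_pos.mpr hc
    obtain ⟨q, hq, hq3, hle⟩ := exists_cube_root_scale hd hc0
    -- With these parameters the edges that meet the measured set cost `4 / B = 4 q`, and the
    -- correlations on the other edges cost `3 q`.
    obtain ⟨C, hC⟩ := edgeDist_sepApprox_le_of_isRegular G hc hG hρ (B := 1 / q) (t := q / d)
      (by positivity) (by positivity)
    refine ⟨_, sepApprox_isSeparable hρ C, hC.trans ?_⟩
    have e : d * (q / d + 2 * (1 / q) / (c * (q / d))) + 4 / (1 / q)
        = 5 * q + 2 * ((d : ℝ) ^ 2 / c) / q ^ 2 := by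
      field_simp; ring
    rw [e, ← hq3, show 2 * q ^ 3 / q ^ 2 = 2 * q by field_simp]
    linarith

theorem exists_isSeparable_edgeDist_starGraph_le (r : V) (hV : 2 ≤ Fintype.card V)
    (hρ : IsState ρ) :
    ∃ σ : Matrix (V → Fin d) (V → Fin d) ℂ, IsSeparable σ ∧
      edgeDist (SimpleGraph.starGraph r) ρ σ
        ≤ 22 * ((d : ℝ) ^ 2 * Real.log d / ((Fintype.card V : ℝ) - 1)) ^ (1 / 3 : ℝ) := by
  obtain rfl | rfl | hd : d = 0 ∨ d = 1 ∨ 2 ≤ d := by omega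
  · exact (not_isState_of_dim_zero ρ hρ).elim
  · obtain ⟨σ, hσ, h⟩ := exists_isSeparable_edgeDist_eq_zero (SimpleGraph.starGraph r) hρ
    exact ⟨σ, hσ, by simp [h]⟩
  · have : NeZero d := ⟨by omega⟩
    have hd0 : (0 : ℝ) < d := by positivity
    set n : ℝ := (Fintype.card V : ℝ) - 1 with hn
    have hn0 : 0 < n := by
      have : (2 : ℝ) ≤ Fintype.card V := by exact_mod_cast hV
      linarith
    obtain ⟨q, hq, hq3, hle⟩ := exists_cube_root_scale hd hn0
    -- The measured leaves cost `2 q` and the correlations `3 q`.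
    obtain ⟨C, hC⟩ := edgeDist_starGraph_sepApprox_le r hV hρ (B := 1 / (n * q)) (t := q / d)
      (by positivity) (by positivity)
    refine ⟨_, sepApprox_isSeparable hρ C, hC.trans ?_⟩
    have e : d * (q / d + 2 * (1 / (n * q)) / (q / d)) + 2 / (1 / (n * q) * n)
        = 3 * q + 2 * ((d : ℝ) ^ 2 / n) / q ^ 2 := by
      field_simp; ring
    rw [← hn, e, ← hq3, show 2 * q ^ 3 / q ^ 2 = 2 * q by field_simp]
    linarith

end Main

end QuditGraph

end

theorem theorem10 {V : Type*} [Fintype V] [DecidableEq V] [Nonempty V] (d : ℕ) :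
    (∀ (G : SimpleGraph V) [DecidableRel G.Adj] (c : ℕ), 1 ≤ c → G.IsRegularOfDegree c →
      ∀ ρ : Matrix (V → Fin d) (V → Fin d) ℂ, QuditGraph.IsState ρ →
        ∃ σ : Matrix (V → Fin d) (V → Fin d) ℂ, QuditGraph.IsSeparable σ ∧
          QuditGraph.edgeDist G ρ σ ≤
            12 * ((d : ℝ) ^ 2 * Real.log d / (c : ℝ)) ^ (1 / 3 : ℝ)) ∧
    (∀ r : V, 2 ≤ Fintype.card V →
      ∀ ρ : Matrix (V → Fin d) (V → Fin d) ℂ, QuditGraph.IsState ρ →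
        ∃ σ : Matrix (V → Fin d) (V → Fin d) ℂ, QuditGraph.IsSeparable σ ∧
          QuditGraph.edgeDist (SimpleGraph.starGraph r) ρ σ ≤
            22 * ((d : ℝ) ^ 2 * Real.log d / ((Fintype.card V : ℝ) - 1)) ^ (1 / 3 : ℝ)) :=
  ⟨fun G _ _ hc hG _ hρ =>
      QuditGraph.exists_isSeparable_edgeDist_le_of_isRegular G hc hG hρ,
    fun r hV _ hρ => QuditGraph.exists_isSeparable_edgeDist_starGraph_le r hV hρ⟩
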